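/- Let $\mathfrak g$ be a finite-dimensional real semisimple Lie algebra, $\Theta$ a Cartan involution of $\mathfrak g$, and $\mathfrak a$ a maximal abelian subspace of the $(-1)$-eigenspace of $\Theta$. For $\alpha\in\mathfrak a^*$ put $\mathfrak g_\alpha=\{x\in\mathfrak g : [H,x]=\alpha(H)x \text{ for all } H\in\mathfrak a\}$, let $\Delta=\{\alpha\neq 0:\mathfrak g_\alpha\neq 0\}$ be the set of restricted roots, fix a notion of positivity on $\mathfrak a^*$, and let $\mathfrak g_+=\bigoplus_{\alpha\in\Delta,\ \alpha>0}\mathfrak g_\alpha$. Let $\mathfrak h$ be a subalgebra of $\mathfrak g$ and $\langle\cdot,\cdot\rangle$ a symmetric bilinear form on $\mathfrak g$ with kernel $\mathfrak h$. Let $\mathfrak p$ be the subalgebra of all $x\in\mathfrak g$ for which there is $c\in\mathbb R$ with $\langle[x,u],v\rangle+\langle u,[x,v]\rangle=c\,\langle u,v\rangle$ for all $u,v\in\mathfrak g$. Assume that $\mathfrak a\oplus\mathfrak g_+\subseteq\mathfrak p$, that the distortion $\delta:\mathfrak a\to\mathbb R$, i.e. the linear form with $\langle[H,u],v\rangle+\langle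 u,[H,v]\rangle=\delta(H)\langle u,v\rangle$ for all $H\in\mathfrak a$ and $u,v\in\mathfrak g$, is non-zero, and that $\mathfrak g_0\not\subseteq\mathfrak h$ (in this case $\delta$ is a root). Let $\Gamma_\delta=\{n\delta\in\Delta : n\in\mathbb Z\}$, let $\mathfrak g_{\Gamma_\delta}=\mathfrak g_0\oplus\bigoplus_{\alpha\in\Gamma_\delta}\mathfrak g_\alpha$, a reductive subalgebra of $\mathfrak g$, and let $\hat{\mathfrak g}(\delta)$ be its non-compact semisimple part, i.e. the sum of its non-compact simple ideals. Then $2\delta$ is not a root, and the Lie algebra $\hat{\mathfrak g}(\delta)$ is isomorphic to the Möbius Lie algebra $\mathfrak{so}(1,n+1)$, where $n=\dim\mathfrak g_\delta\geq 1$. -/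

import Mathlib

/-- A Cartan involution of a real Lie algebra: an involutive automorphism `θ` such that the bilinear
form `-B(x, θ y)` is positive definite, `B` being the Killing form. -/
structure IsCartanInvolution {g : Type*} [LieRing g] [LieAlgebra ℝ g]
    (θ : g ≃ₗ⁅ℝ⁆ g) : Prop where
  involutive : ∀ x, θ (θ x) = x
  pos_def : ∀ x, x ≠ 0 → 0 < -killingForm ℝ g x (θ x)

/-- `a` is a maximal abelian subspace of the `-1`-eigenspace of `θ`. -/
structure IsCartanSubspace {g : Type*} [LieRing g] [LieAlgebra ℝ g]
    (θ : g ≃ₗ⁅ℝ⁆ g) (a : Submodule ℝ g) : Prop where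
  neg : ∀ x ∈ a, θ x = -x
  abelian : ∀ x ∈ a, ∀ y ∈ a, ⁅x, y⁆ = 0
  maximal : ∀ x, θ x = -x → (∀ y ∈ a, ⁅x, y⁆ = 0) → x ∈ a

/-- The space `g_α = {x | [H, x] = α(H) x for all H ∈ a}`. In particular `g_0` is the centralizer
of `a`. -/
def restrictedRootSpace {g : Type*} [LieRing g] [LieAlgebra ℝ g]
    (a : Submodule ℝ g) (α : Module.Dual ℝ a) : Submodule ℝ g where
  carrier := {x | ∀ H : a, ⁅(H : g), x⁆ = α H • x}
  add_mem' := by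
    intro x y hx hy H
    rw [lie_add, hx H, hy H, smul_add]
  zero_mem' := by
    intro H
    simp
  smul_mem' := by
    intro c x hx H
    rw [lie_smul, hx H, smul_comm]

/-- The set `Δ` of (restricted) roots of `(g, a)`. -/
def restrictedRoots {g : Type*} [LieRing g] [LieAlgebra ℝ g]
    (a : Submodule ℝ g) : Set (Module.Dual ℝ a) :=
  {α | α ≠ 0 ∧ restrictedRootSpace a α ≠ ⊥}

/-- A notion of positivity on a real vector space: exactly one of `φ`, `-φ` is positive for every
`φ ≠ 0`, and positive elements are stable under sums and positive multiples. -/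
structure IsPositivity {V : Type*} [AddCommGroup V] [Module ℝ V] (pos : V → Prop) : Prop where
  zero : ¬ pos 0
  pos_or_neg : ∀ φ, φ ≠ 0 → pos φ ∨ pos (-φ)
  not_both : ∀ φ, ¬ (pos φ ∧ pos (-φ))
  add : ∀ φ ψ, pos φ → pos ψ → pos (φ + ψ)
  smul : ∀ (c : ℝ) (φ : V), 0 < c → pos φ → pos (c • φ)

/-- `g_+`, the sum of the root spaces of the positive roots. -/
def positivePart {g : Type*} [LieRing g] [LieAlgebra ℝ g]
    (a : Submodule ℝ g) (pos : Module.Dual ℝ a → Prop) : Submodule ℝ g :=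
  ⨆ α ∈ {α | α ∈ restrictedRoots a ∧ pos α}, restrictedRootSpace a α

/-- The subalgebra `p` of all `x` whose adjoint action preserves the form `b` infinitesimally up to
a scalar: `b([x, u], v) + b(u, [x, v]) = c b(u, v)`. -/
def conformalSubalgebra {g : Type*} [LieRing g] [LieAlgebra ℝ g]
    (b : LinearMap.BilinForm ℝ g) : LieSubalgebra ℝ g where
  carrier := {x | ∃ c : ℝ, ∀ u v, b ⁅x, u⁆ v + b u ⁅x, v⁆ = c * b u v}
  add_mem' := by
    rintro x y ⟨c, hc⟩ ⟨d, hd⟩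
    refine ⟨c + d, fun u v => ?_⟩
    simp only [add_lie, map_add, LinearMap.add_apply]
    linear_combination hc u v + hd u v
  zero_mem' := ⟨0, fun u v => by simp⟩
  smul_mem' := by
    rintro r x ⟨c, hc⟩
    refine ⟨r * c, fun u v => ?_⟩
    simp only [smul_lie, map_smul, LinearMap.smul_apply, smul_eq_mul]
    linear_combination r * hc u v
  lie_mem' := by
    rintro x y ⟨c, hc⟩ ⟨d, hd⟩
    refine ⟨0, fun u v => ?_⟩
    simp only [lie_lie, map_sub, LinearMap.sub_apply]
    linear_combination hc ⁅y, u⁆ v + hc u ⁅y, v⁆ - d * hc u v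
      - hd ⁅x, u⁆ v - hd u ⁅x, v⁆ + c * hd u v

/-- The algebraic setting for a semisimple Lie algebra `g` with root data `(a, pos)`: the triple
`(g, h, b)` together with its distortion `δ : a → ℝ`. The form `b` is symmetric with kernel the
subalgebra `h`, it is infinitesimally preserved up to scalars by `a ⊕ g_+`, and `δ` is the
(nontrivial) linear form giving the scalar by which `a` acts on `b`. -/
structure IsAlgebraicFormulation {g : Type*} [LieRing g] [LieAlgebra ℝ g]
    (a : Submodule ℝ g) (pos : Module.Dual ℝ a → Prop)
    (h : LieSubalgebra ℝ g) (b : LinearMap.BilinForm ℝ g) (δ : Module.Dual ℝ a) : Prop where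
  symm : ∀ u v, b u v = b v u
  ker : ∀ u, u ∈ h ↔ ∀ v, b u v = 0
  parabolic : a ⊔ positivePart a pos ≤ (conformalSubalgebra b).toSubmodule
  distortion : ∀ (H : a) (u v : g), b ⁅(H : g), u⁆ v + b u ⁅(H : g), v⁆ = δ H * b u v
  distortion_ne_zero : δ ≠ 0

/-- A closed set of roots: `α, β ∈ Γ` and `α + β ∈ Δ` imply `α + β ∈ Γ`. -/
structure IsClosedRootSet {g : Type*} [LieRing g] [LieAlgebra ℝ g]
    (a : Submodule ℝ g) (Γ : Set (Module.Dual ℝ a)) : Prop where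
  subset : Γ ⊆ restrictedRoots a
  add : ∀ α ∈ Γ, ∀ β ∈ Γ, α + β ∈ restrictedRoots a → α + β ∈ Γ

theorem lie_mem_restrictedRootSpace {g : Type*} [LieRing g] [LieAlgebra ℝ g]
    {a : Submodule ℝ g} {α β : Module.Dual ℝ a} {x y : g}
    (hx : x ∈ restrictedRootSpace a α) (hy : y ∈ restrictedRootSpace a β) :
    ⁅x, y⁆ ∈ restrictedRootSpace a (α + β) := by
  intro H
  rw [leibniz_lie, hx H, hy H, smul_lie, lie_smul, LinearMap.add_apply, add_smul]

/-- The vector space `g_0 ⊕ ⨁_{α ∈ Γ} g_α`. -/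
def rootSubmodule {g : Type*} [LieRing g] [LieAlgebra ℝ g]
    (a : Submodule ℝ g) (Γ : Set (Module.Dual ℝ a)) : Submodule ℝ g :=
  restrictedRootSpace a 0 ⊔ ⨆ α ∈ Γ, restrictedRootSpace a α

theorem rootSubmodule_eq {g : Type*} [LieRing g] [LieAlgebra ℝ g]
    (a : Submodule ℝ g) (Γ : Set (Module.Dual ℝ a)) :
    rootSubmodule a Γ = ⨆ α ∈ insert 0 Γ, restrictedRootSpace a α := by
  rw [rootSubmodule, iSup_insert]

theorem restrictedRootSpace_le_rootSubmodule {g : Type*} [LieRing g] [LieAlgebra ℝ g]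
    {a : Submodule ℝ g} {Γ : Set (Module.Dual ℝ a)} (hΓ : IsClosedRootSet a Γ)
    {α β : Module.Dual ℝ a} (hα : α ∈ insert 0 Γ) (hβ : β ∈ insert 0 Γ) :
    restrictedRootSpace a (α + β) ≤ rootSubmodule a Γ := by
  have key : ∀ γ ∈ insert 0 Γ, restrictedRootSpace a γ ≤ rootSubmodule a Γ := by
    intro γ hγ
    rw [rootSubmodule_eq]
    exact le_iSup₂_of_le γ hγ le_rfl
  by_cases h0 : α + β = 0
  · rw [h0]
    exact key 0 (Set.mem_insert _ _)
  by_cases hb : restrictedRootSpace a (α + β) = ⊥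
  · rw [hb]
    exact bot_le
  rcases hα with rfl | hα
  · rw [zero_add]
    exact key β hβ
  rcases hβ with rfl | hβ
  · rw [add_zero]
    exact key α (Set.mem_insert_of_mem _ hα)
  exact key _ (Set.mem_insert_of_mem _ (hΓ.add α hα β hβ ⟨h0, hb⟩))

/-- The subalgebra `g_Γ = g_0 ⊕ ⨁_{α ∈ Γ} g_α` attached to a closed set of roots `Γ`. -/
def rootSubalgebra {g : Type*} [LieRing g] [LieAlgebra ℝ g]
    (a : Submodule ℝ g) (Γ : Set (Module.Dual ℝ a)) (hΓ : IsClosedRootSet a Γ) :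
    LieSubalgebra ℝ g where
  toSubmodule := rootSubmodule a Γ
  lie_mem' := by
    intro x y hx hy
    change ⁅x, y⁆ ∈ rootSubmodule a Γ
    replace hx : x ∈ ⨆ α ∈ insert 0 Γ, restrictedRootSpace a α := rootSubmodule_eq a Γ ▸ hx
    replace hy : y ∈ ⨆ α ∈ insert 0 Γ, restrictedRootSpace a α := rootSubmodule_eq a Γ ▸ hy
    have h1 : ∀ α ∈ insert 0 Γ, ∀ u ∈ restrictedRootSpace a α, ⁅u, y⁆ ∈ rootSubmodule a Γ := by
      intro α hα u hu
      have : (⨆ β ∈ insert 0 Γ, restrictedRootSpace a β) ≤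
          (rootSubmodule a Γ).comap (LieAlgebra.ad ℝ g u : g →ₗ[ℝ] g) := by
        refine iSup₂_le fun β hβ v hv => ?_
        exact restrictedRootSpace_le_rootSubmodule hΓ hα hβ (lie_mem_restrictedRootSpace hu hv)
      exact this hy
    have h2 : (⨆ α ∈ insert 0 Γ, restrictedRootSpace a α) ≤
        (rootSubmodule a Γ).comap (LieAlgebra.ad ℝ g y : g →ₗ[ℝ] g) := by
      refine iSup₂_le fun α hα u hu => ?_
      change ⁅y, u⁆ ∈ rootSubmodule a Γ
      rw [← lie_skew]
      exact neg_mem (h1 α hα u hu)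
    have h3 : ⁅y, x⁆ ∈ rootSubmodule a Γ := h2 hx
    rw [← lie_skew]
    exact neg_mem h3

/-- `Γ_δ`, the set of integer multiples of `δ` that are roots. -/
def rootMultiples {g : Type*} [LieRing g] [LieAlgebra ℝ g]
    (a : Submodule ℝ g) (δ : Module.Dual ℝ a) : Set (Module.Dual ℝ a) :=
  {α | α ∈ restrictedRoots a ∧ ∃ n : ℤ, α = n • δ}

theorem isClosedRootSet_rootMultiples {g : Type*} [LieRing g] [LieAlgebra ℝ g]
    (a : Submodule ℝ g) (δ : Module.Dual ℝ a) : IsClosedRootSet a (rootMultiples a δ) where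
  subset := fun _ hα => hα.1
  add := by
    rintro α ⟨-, n, rfl⟩ β ⟨-, m, rfl⟩ h
    exact ⟨h, n + m, (add_smul n m δ).symm⟩

/-- The reductive subalgebra `g_{Γ_δ}`. -/
def multiplesSubalgebra {g : Type*} [LieRing g] [LieAlgebra ℝ g]
    (a : Submodule ℝ g) (δ : Module.Dual ℝ a) : LieSubalgebra ℝ g :=
  rootSubalgebra a (rootMultiples a δ) (isClosedRootSet_rootMultiples a δ)

/-- The non-compact semisimple part of a reductive real Lie algebra: the sum of its non-compact
simple ideals. A simple real Lie algebra is compact if its Killing form is negative definite. -/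
def noncompactSemisimplePart (L : Type*) [LieRing L] [LieAlgebra ℝ L] : LieIdeal ℝ L :=
  sSup {I : LieIdeal ℝ L | LieAlgebra.IsSimple ℝ I ∧
    ¬ ∀ x : I, x ≠ 0 → killingForm ℝ I x x < 0}

/-- `ĝ(δ)`, the non-compact semisimple part of `g_{Γ_δ}`. -/
def mobiusSubalgebra {g : Type*} [LieRing g] [LieAlgebra ℝ g]
    (a : Submodule ℝ g) (δ : Module.Dual ℝ a) : LieIdeal ℝ (multiplesSubalgebra a δ) :=
  noncompactSemisimplePart (multiplesSubalgebra a δ)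

/-! The distortion identity makes the form a weight pairing: `b` can pair `g_l` with `g_m` only if
`l + m = δ`. An element of `g_0` outside `h` therefore has a partner in `g_δ`, so `δ` is a root
(`exists_apply_ne_zero`). Testing a positive root vector on such a pair shows that its conformal
factor is zero, so it acts skewly on `b` (`lie_skew_adjoint`). If `δ` were positive, skewness would
annihilate that pair; hence `-δ` is positive. Skewness of `θ y` for `y` in `g_δ` and of `θ f` for
`f` in `g_{2δ}`, together with the absence of roots `±3δ`, then excludes `2δ`.

Once `2δ` is excluded, `g_{Γ_δ} = g_0 ⊕ g_δ ⊕ g_{-δ}`. The span `R` of `g_{±δ}` and their brackets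
is an ideal of it, and every nonzero ideal of `R` contains the Killing dual `A` of `δ` and hence all
of `R`, so `R` is simple. Since `θ A = -A`, it is non-compact. A simple ideal not contained in `R`
meets it trivially, commutes with `A`, lies in `g_0`, and is fixed pointwise by `θ`, so it is
compact. Thus `ĝ(δ) = R` (`mobiusSubalgebra_eq_rankOneIdeal`).

The `-1`-eigenspace of `θ` on `R` consists of the vectors `s A + (u - θ u)` with `u` in `g_δ` and
has dimension `n + 1`. For the inner product `δ(A) B`, where `B` is the Killing form, its triple
bracket is the curvature tensor of hyperbolic space (`lie_triple`). Letting `R` act on the sum of a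
line and this eigenspace, as Killing fields act in the hyperboloid model, gives the isomorphism with
`so(1, n + 1)`. -/

theorem LinearMap.BilinForm.exists_forall_apply_eq_of_anisotropic {V : Type*} [AddCommGroup V]
    [Module ℝ V] [FiniteDimensional ℝ V] (β : LinearMap.BilinForm ℝ V)
    (hβ : ∀ x, β x x = 0 → x = 0) (f : Module.Dual ℝ V) : ∃ z, ∀ v, β z v = f v := by
  have hinj : Function.Injective β := by
    rw [← LinearMap.ker_eq_bot, LinearMap.ker_eq_bot']
    intro x hx
    exact hβ x (by rw [hx]; rfl)
  have hsurj : Function.Surjective β :=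
    (LinearMap.injective_iff_surjective_of_finrank_eq_finrank
      (Subspace.dual_finrank_eq (K := ℝ) (V := V)).symm).1 hinj
  obtain ⟨z, hz⟩ := hsurj f
  exact ⟨z, fun v => by rw [hz]⟩

/-! ### Invariance of the Killing form and its duality under a Cartan involution. -/

section CartanInvolution

variable {g : Type*} [LieRing g] [LieAlgebra ℝ g]

theorem killingForm_lie_left (x y z : g) :
    killingForm ℝ g ⁅x, y⁆ z = killingForm ℝ g x ⁅y, z⁆ :=
  LieModule.traceForm_apply_lie_apply ℝ g g x y z

theorem killingForm_comm (x y : g) : killingForm ℝ g x y = killingForm ℝ g y x :=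
  LieModule.traceForm_comm ℝ g g x y

theorem killingForm_lie_right (x y z : g) :
    killingForm ℝ g y ⁅x, z⁆ = -killingForm ℝ g ⁅x, y⁆ z := by
  rw [← killingForm_lie_left, ← lie_skew, map_neg, LinearMap.neg_apply]

theorem killingForm_map_map [FiniteDimensional ℝ g] (θ : g ≃ₗ⁅ℝ⁆ g) (x y : g) :
    killingForm ℝ g (θ x) (θ y) = killingForm ℝ g x y :=
  LieAlgebra.killingForm_of_equiv_apply ..

namespace IsCartanInvolution

variable {θ : g ≃ₗ⁅ℝ⁆ g}

theorem killingForm_neg (hθ : IsCartanInvolution θ) {x : g} (hx : x ≠ 0) :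
    killingForm ℝ g x (θ x) < 0 := by
  have := hθ.pos_def x hx
  linarith

theorem killingForm_map_right [FiniteDimensional ℝ g] (hθ : IsCartanInvolution θ) (x y : g) :
    killingForm ℝ g x (θ y) = killingForm ℝ g (θ x) y := by
  rw [← killingForm_map_map θ x (θ y), hθ.involutive]

theorem exists_killingForm_eq [FiniteDimensional ℝ g] (hθ : IsCartanInvolution θ)
    (f : Module.Dual ℝ g) : ∃ z, ∀ v, killingForm ℝ g z v = f v := by
  obtain ⟨z, hz⟩ := LinearMap.BilinForm.exists_forall_apply_eq_of_anisotropic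
    ((killingForm ℝ g).compl₂ (θ : g →ₗ[ℝ] g))
    (fun x hx => by_contra fun h => (hθ.killingForm_neg h).ne hx) f
  exact ⟨θ z, fun v => by rw [← hz v, ← hθ.killingForm_map_right]; rfl⟩

end IsCartanInvolution

end CartanInvolution

/-! ### Restricted root spaces, dual vectors and multiples of a root. -/

section RestrictedRoots

variable {g : Type*} [LieRing g] [LieAlgebra ℝ g] {θ : g ≃ₗ⁅ℝ⁆ g} {a : Submodule ℝ g}

theorem restrictedRootSpace_eq_bot {α : Module.Dual ℝ a} (h0 : α ≠ 0)
    (hα : α ∉ restrictedRoots a) : restrictedRootSpace a α = ⊥ :=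
  by_contra fun h => hα ⟨h0, h⟩

theorem IsCartanSubspace.map_mem (ha : IsCartanSubspace θ a) {α : Module.Dual ℝ a} {x : g}
    (hx : x ∈ restrictedRootSpace a α) : θ x ∈ restrictedRootSpace a (-α) := by
  intro H
  have h1 := congrArg θ (hx H)
  rw [LieEquiv.map_lie, ha.neg _ H.2, neg_lie, map_smul] at h1
  rw [← neg_neg ⁅(H : g), θ x⁆, h1, LinearMap.neg_apply, neg_smul]

theorem killingForm_eq_zero_of_add_ne_zero {α β : Module.Dual ℝ a} {x y : g}
    (hx : x ∈ restrictedRootSpace a α) (hy : y ∈ restrictedRootSpace a β) (h : α + β ≠ 0) :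
    killingForm ℝ g x y = 0 := by
  by_contra hne
  refine h (LinearMap.ext fun H => ?_)
  have h1 := killingForm_lie_right (H : g) x y
  rw [hx H, hy H, map_smul, map_smul, LinearMap.smul_apply, smul_eq_mul, smul_eq_mul] at h1
  have h2 : (α H + β H) * killingForm ℝ g x y = 0 := by linarith
  simpa [hne] using h2

theorem IsCartanSubspace.killingForm_pos (hθ : IsCartanInvolution θ) (ha : IsCartanSubspace θ a)
    {H : a} (hH : H ≠ 0) : 0 < killingForm ℝ g H H := by
  have := hθ.killingForm_neg (x := (H : g)) (by simpa using hH)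
  rw [ha.neg _ H.2, map_neg] at this
  linarith

theorem restrictedRootSpace_le_eigenspace (α : Module.Dual ℝ a) (H : a) :
    restrictedRootSpace a α ≤ Module.End.eigenspace (LieAlgebra.ad ℝ g (H : g)) (α H) :=
  fun _ hx => Module.End.mem_eigenspace_iff.2 (hx H)

theorem IsCartanSubspace.dual_apply_self_pos (hθ : IsCartanInvolution θ)
    (ha : IsCartanSubspace θ a) {α : Module.Dual ℝ a} (hα : α ≠ 0) {A : a}
    (hA : ∀ H : a, killingForm ℝ g A H = α H) : 0 < α A := by
  rw [← hA]
  refine ha.killingForm_pos hθ ?_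
  rintro rfl
  exact hα (LinearMap.ext fun H => by rw [← hA]; simp)

variable [FiniteDimensional ℝ g]

theorem IsCartanSubspace.exists_dual (hθ : IsCartanInvolution θ) (ha : IsCartanSubspace θ a)
    (α : Module.Dual ℝ a) : ∃ A : a, ∀ H : a, killingForm ℝ g A H = α H :=
  LinearMap.BilinForm.exists_forall_apply_eq_of_anisotropic
    ((killingForm ℝ g).restrict a)
    (fun _ hx => by_contra fun h => (ha.killingForm_pos hθ h).ne' hx) α

/-- The symmetrized bracket is negated by `θ` and commutes with `a`, so maximality puts it in `a`.
There the Killing form is positive definite, and pairing with each `H` identifies the vector.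
Symmetrizing is essential: a single `⁅u, θ v⁆` may have a component fixed by `θ`. -/
theorem IsCartanSubspace.lie_map_add_lie_map (hθ : IsCartanInvolution θ)
    (ha : IsCartanSubspace θ a) {α : Module.Dual ℝ a} {A : a}
    (hA : ∀ H : a, killingForm ℝ g A H = α H) {u v : g}
    (hu : u ∈ restrictedRootSpace a α) (hv : v ∈ restrictedRootSpace a α) :
    ⁅u, θ v⁆ + ⁅v, θ u⁆ = (2 * killingForm ℝ g u (θ v)) • (A : g) := by
  have hmem : ⁅u, θ v⁆ + ⁅v, θ u⁆ ∈ a := by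
    refine ha.maximal _ ?_ ?_
    · rw [map_add, LieEquiv.map_lie, LieEquiv.map_lie, hθ.involutive, hθ.involutive,
        ← lie_skew v, ← lie_skew u]
      abel
    · intro y hy
      have h1 := lie_mem_restrictedRootSpace hu (ha.map_mem hv) ⟨y, hy⟩
      have h2 := lie_mem_restrictedRootSpace hv (ha.map_mem hu) ⟨y, hy⟩
      rw [← lie_skew, lie_add]
      simp only [add_neg_cancel, LinearMap.zero_apply, zero_smul] at h1 h2
      rw [h1, h2, add_zero, neg_zero]
  have key : ∀ H : a, killingForm ℝ g (⁅u, θ v⁆ + ⁅v, θ u⁆) H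
      = killingForm ℝ g ((2 * killingForm ℝ g u (θ v)) • (A : g)) H := by
    intro H
    have e : ∀ p q : g, p ∈ restrictedRootSpace a α → q ∈ restrictedRootSpace a α →
        killingForm ℝ g ⁅p, θ q⁆ H = α H * killingForm ℝ g p (θ q) := by
      intro p q _ hq
      rw [killingForm_lie_left, ← lie_skew, ha.map_mem hq H]
      simp
    rw [map_add, LinearMap.add_apply, e u v hu hv, e v u hv hu, hθ.killingForm_map_right v u,
      killingForm_comm (θ v), map_smul, LinearMap.smul_apply, hA, smul_eq_mul]
    ring
  have hz : (⟨_, hmem⟩ : a) - (2 * killingForm ℝ g u (θ v)) • A = 0 := by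
    by_contra hne
    have := ha.killingForm_pos hθ hne
    generalize hw : (⟨_, hmem⟩ : a) - (2 * killingForm ℝ g u (θ v)) • A = w at this
    have h3 := key w
    have h4 : (w : g) = ⁅u, θ v⁆ + ⁅v, θ u⁆ - (2 * killingForm ℝ g u (θ v)) • (A : g) := by
      rw [← hw]; rfl
    nth_rewrite 1 [h4] at this
    rw [map_sub, LinearMap.sub_apply, h3, sub_self] at this
    exact this.ne rfl
  simpa [sub_eq_zero] using congrArg (Subtype.val) hz

theorem IsCartanSubspace.lie_map_self (hθ : IsCartanInvolution θ)
    (ha : IsCartanSubspace θ a) {α : Module.Dual ℝ a} {A : a}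
    (hA : ∀ H : a, killingForm ℝ g A H = α H) {u : g} (hu : u ∈ restrictedRootSpace a α) :
    ⁅u, θ u⁆ = killingForm ℝ g u (θ u) • (A : g) := by
  have h := ha.lie_map_add_lie_map hθ hA hu hu
  rw [← two_smul ℝ, mul_smul] at h
  exact smul_right_injective g (two_ne_zero (α := ℝ)) h

/-- For `α H ≠ 0`, distinct `n` give distinct eigenvalues `n α(H)` of `ad H`. -/
theorem finite_setOf_restrictedRootSpace_nsmul_ne_bot {α : Module.Dual ℝ a} (hα : α ≠ 0) :
    {n : ℕ | restrictedRootSpace a ((n : ℝ) • α) ≠ ⊥}.Finite := by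
  obtain ⟨H, hH⟩ : ∃ H, α H ≠ 0 := by
    by_contra! h
    exact hα (LinearMap.ext h)
  refine Set.Finite.of_finite_image (f := fun n : ℕ => (n : ℝ) * α H)
    ((Module.End.finite_hasEigenvalue (LieAlgebra.ad ℝ g (H : g))).subset ?_) ?_
  · rintro _ ⟨n, hn, rfl⟩ h
    exact hn (le_bot_iff.1 (h ▸ restrictedRootSpace_le_eigenspace ((n : ℝ) • α) H))
  · intro m _ n _ h
    simpa [hH] using h

/-- Restricted roots have no integral multiples `n α` with `n ≥ 3` among the roots. -/
theorem IsCartanSubspace.restrictedRootSpace_nsmul_eq_bot (hθ : IsCartanInvolution θ)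
    (ha : IsCartanSubspace θ a) {α : Module.Dual ℝ a} (hα : α ∈ restrictedRoots a)
    {n : ℕ} (hn : 3 ≤ n) : restrictedRootSpace a ((n : ℝ) • α) = ⊥ := by
  by_contra hne
  obtain ⟨N, hNmem, hNmax⟩ := Set.exists_max_image _ id
    (finite_setOf_restrictedRootSpace_nsmul_ne_bot (g := g) hα.1) ⟨n, hne⟩
  have hN3 : 3 ≤ N := hn.trans (hNmax n hne)
  have hN0 : (N : ℝ) ≠ 0 := by positivity
  obtain ⟨u, hu, hu0⟩ := (Submodule.ne_bot_iff _).1 hNmem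
  obtain ⟨w, hw, hw0⟩ := (Submodule.ne_bot_iff _).1 hα.2
  obtain ⟨A, hA⟩ := ha.exists_dual hθ α
  have hAA := ha.dual_apply_self_pos hθ hα.1 hA
  have hk := hθ.killingForm_neg hu0
  have hlie := ha.lie_map_self hθ (A := (N : ℝ) • A)
    (fun H => by simp [hA]) hu
  set k := killingForm ℝ g u (θ u)
  -- The largest multiple `N α` yields an `sl₂`-triple through `u`. A vector `w` of `g_α` is
  -- primitive for it, because `(N + 1) α` is not a root. Its weight `2 / N` would have to be a
  -- natural number, which fails for `N ≥ 3`.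
  have t : IsSl2Triple ((2 / (N * α A)) • (A : g)) u ((2 / (N * N * α A * k)) • θ u) := by
    refine ⟨?_, ?_, ?_, ?_⟩
    · refine smul_ne_zero (by positivity) ?_
      intro h
      have : A = 0 := by simpa using h
      simp [this] at hAA
    · rw [lie_smul, hlie, Submodule.coe_smul, smul_smul, smul_smul]
      congr 1
      have := hk.ne
      field_simp
    · rw [smul_lie, hu A, smul_smul, ← Nat.cast_smul_eq_nsmul ℝ]
      congr 1
      simp only [LinearMap.smul_apply, smul_eq_mul, Nat.cast_ofNat]
      field_simp
    · rw [smul_lie, lie_smul, ha.map_mem hu A, ← Nat.cast_smul_eq_nsmul ℝ, smul_smul, smul_smul,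
        smul_smul, ← neg_smul]
      congr 1
      have := hk.ne
      simp only [LinearMap.neg_apply, LinearMap.smul_apply, smul_eq_mul, Nat.cast_ofNat]
      field_simp
  have hP : t.HasPrimitiveVectorWith w (2 / N : ℝ) := by
    refine ⟨hw0, ?_, ?_⟩
    · rw [smul_lie, hw A, smul_smul]
      congr 1
      field_simp
    · have h1 := lie_mem_restrictedRootSpace hu hw
      have h2 : (N : ℝ) • α + α = ((N + 1 : ℕ) : ℝ) • α := by
        push_cast
        module
      have h3 : restrictedRootSpace a (((N + 1 : ℕ) : ℝ) • α) = ⊥ := by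
        by_contra h
        have : N + 1 ≤ N := hNmax (N + 1) h
        omega
      rw [h2, h3] at h1
      simpa using h1
  obtain ⟨m, hm⟩ := hP.exists_nat
  rw [div_eq_iff hN0] at hm
  have hm' : 2 = m * N := by exact_mod_cast hm
  rcases m with _ | m
  · simp at hm'
  · nlinarith

end RestrictedRoots

/-! ### Weights of the form, sign of the distortion, and exclusion of `2δ`. -/

namespace IsAlgebraicFormulation

variable {g : Type*} [LieRing g] [LieAlgebra ℝ g] {θ : g ≃ₗ⁅ℝ⁆ g} {a : Submodule ℝ g}
  {pos : Module.Dual ℝ a → Prop} {h : LieSubalgebra ℝ g} {b : LinearMap.BilinForm ℝ g}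
  {δ : Module.Dual ℝ a}

theorem apply_eq_zero_of_add_ne (hform : IsAlgebraicFormulation a pos h b δ)
    {l m : Module.Dual ℝ a} {x y : g} (hx : x ∈ restrictedRootSpace a l)
    (hy : y ∈ restrictedRootSpace a m) (hlm : l + m ≠ δ) : b x y = 0 := by
  by_contra hne
  refine hlm (LinearMap.ext fun H => ?_)
  have h1 := hform.distortion H x y
  rw [hx H, hy H, map_smul, map_smul, LinearMap.smul_apply, smul_eq_mul, smul_eq_mul,
    ← add_mul] at h1
  exact mul_right_cancel₀ hne h1

variable [FiniteDimensional ℝ g]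

/-- This replaces an appeal to the root space decomposition of `g`. The Killing representative `z`
of `b x` has weight `-m`, so `θ z` lies in `g_m`, and evaluating `b x` there gives a negative number
unless `z = 0`. -/
theorem apply_eq_zero_of_forall (hθ : IsCartanInvolution θ) (ha : IsCartanSubspace θ a)
    (hform : IsAlgebraicFormulation a pos h b δ) {l m : Module.Dual ℝ a} (hlm : l + m = δ) {x : g}
    (hx : x ∈ restrictedRootSpace a l) (hb : ∀ y ∈ restrictedRootSpace a m, b x y = 0) (v : g) :
    b x v = 0 := by
  obtain ⟨z, hz⟩ := hθ.exists_killingForm_eq (b x)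
  suffices z = 0 by rw [← hz, this, map_zero, LinearMap.zero_apply]
  have hzmem : z ∈ restrictedRootSpace a (-m) := by
    intro H
    by_contra hne
    -- The failure `w` of `z` to have weight `-m`. By the distortion identity it is
    -- Killing-orthogonal to everything, in particular to `θ w`.
    obtain ⟨w, hw⟩ : ∃ w, w = ⁅(H : g), z⁆ - (-m) H • z := ⟨_, rfl⟩
    have hw0 : w ≠ 0 := by rwa [hw, sub_ne_zero]
    refine (hθ.killingForm_neg hw0).ne ?_
    have h1 := hform.distortion H x (θ w)
    rw [hx H, map_smul, LinearMap.smul_apply, ← hz, ← hz, killingForm_lie_right, ← hlm] at h1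
    nth_rewrite 1 [hw]
    simp only [map_sub, map_smul, LinearMap.sub_apply, LinearMap.smul_apply, LinearMap.neg_apply,
      smul_eq_mul, LinearMap.add_apply] at h1 ⊢
    linarith
  by_contra hz0
  refine (hθ.killingForm_neg hz0).ne ?_
  rw [hz]
  refine hb _ ?_
  simpa using ha.map_mem hzmem

theorem exists_apply_ne_zero (hθ : IsCartanInvolution θ) (ha : IsCartanSubspace θ a)
    (hform : IsAlgebraicFormulation a pos h b δ)
    (hg0 : ¬ restrictedRootSpace a 0 ≤ h.toSubmodule) :
    ∃ x ∈ restrictedRootSpace a 0, ∃ y ∈ restrictedRootSpace a δ, b x y ≠ 0 := by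
  by_contra! hb
  refine hg0 fun x hx => (hform.ker x).2 ?_
  exact hform.apply_eq_zero_of_forall hθ ha (zero_add δ) hx (hb x hx)

/-- The conformal factor is read off on a pair `p ∈ g_0`, `q ∈ g_δ` with `b p q ≠ 0`. Applying `x`
shifts the total weight to `δ + β ≠ δ`, so the left side vanishes there and the factor is zero. -/
theorem lie_skew_adjoint (hpos : IsPositivity pos) (hθ : IsCartanInvolution θ)
    (ha : IsCartanSubspace θ a) (hform : IsAlgebraicFormulation a pos h b δ)
    (hg0 : ¬ restrictedRootSpace a 0 ≤ h.toSubmodule) {β : Module.Dual ℝ a} (hβ : pos β) {x : g}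
    (hx : x ∈ restrictedRootSpace a β) (u v : g) : b ⁅x, u⁆ v + b u ⁅x, v⁆ = 0 := by
  have hβ0 : β ≠ 0 := by
    rintro rfl
    exact hpos.zero hβ
  by_cases hx0 : x = 0
  · simp [hx0]
  have hroot : β ∈ restrictedRoots a := ⟨hβ0, (Submodule.ne_bot_iff _).2 ⟨x, hx, hx0⟩⟩
  obtain ⟨c, hc⟩ : x ∈ conformalSubalgebra b := hform.parabolic <|
    Submodule.mem_sup_right <| Submodule.mem_iSup_of_mem β <|
      Submodule.mem_iSup_of_mem ⟨hroot, hβ⟩ hx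
  obtain ⟨p, hp, q, hq, hpq⟩ := hform.exists_apply_ne_zero hθ ha hg0
  have h1 : b ⁅x, p⁆ q = 0 :=
    hform.apply_eq_zero_of_add_ne (lie_mem_restrictedRootSpace hx hp) hq (by simpa using hβ0)
  have h2 : b p ⁅x, q⁆ = 0 :=
    hform.apply_eq_zero_of_add_ne hp (lie_mem_restrictedRootSpace hx hq) (by simpa using hβ0)
  have h3 := hc p q
  rw [h1, h2, add_zero, eq_comm, mul_eq_zero, or_iff_left hpq] at h3
  rw [hc, h3, zero_mul]

theorem pos_neg_distortion (hpos : IsPositivity pos) (hθ : IsCartanInvolution θ)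
    (ha : IsCartanSubspace θ a) (hform : IsAlgebraicFormulation a pos h b δ)
    (hg0 : ¬ restrictedRootSpace a 0 ≤ h.toSubmodule) : pos (-δ) := by
  refine (hpos.pos_or_neg δ hform.distortion_ne_zero).resolve_left fun hδ => ?_
  obtain ⟨x, hx, y, hy, hxy⟩ := hform.exists_apply_ne_zero hθ ha hg0
  obtain ⟨H, hH⟩ : ∃ H, δ H ≠ 0 := by
    by_contra! hne
    exact hform.distortion_ne_zero (LinearMap.ext hne)
  -- Were `δ` positive, elements of `g_δ` would be skew. Testing `y` on `(H, H)` gives `b y H = 0`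
  -- on all of `g_δ`, which also applies to `⁅y, x⁆`; testing `y` on `(x, H)` then forces `δ(H) b x
  -- y = 0`.
  have hskew := fun y hy => hform.lie_skew_adjoint hpos hθ ha hg0 hδ (x := y) hy
  have h1 : ∀ y ∈ restrictedRootSpace a δ, ⁅y, (H : g)⁆ = -(δ H • y) := by
    intro y hy
    rw [← lie_skew, hy H]
  have h2 : ∀ y ∈ restrictedRootSpace a δ, b y H = 0 := by
    intro y hy
    have := hskew y hy H H
    rw [h1 y hy, hform.symm (H : g)] at this
    simp only [map_neg, map_smul, LinearMap.neg_apply, LinearMap.smul_apply, smul_eq_mul] at this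
    have h3 : δ H * b y H = 0 := by linarith
    exact (mul_eq_zero.1 h3).resolve_left hH
  have h3 : b ⁅y, x⁆ H = 0 := h2 _ (by simpa using lie_mem_restrictedRootSpace hy hx)
  have h6 := hskew y hy x H
  rw [h1 y hy, h3, map_neg, map_smul, zero_add, smul_eq_mul, neg_eq_zero] at h6
  exact (mul_ne_zero hH hxy) h6

theorem distortion_mem_restrictedRoots (hθ : IsCartanInvolution θ) (ha : IsCartanSubspace θ a)
    (hform : IsAlgebraicFormulation a pos h b δ)
    (hg0 : ¬ restrictedRootSpace a 0 ≤ h.toSubmodule) : δ ∈ restrictedRoots a := by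
  obtain ⟨x, -, y, hy, hxy⟩ := hform.exists_apply_ne_zero hθ ha hg0
  refine ⟨hform.distortion_ne_zero, (Submodule.ne_bot_iff _).2 ⟨y, hy, ?_⟩⟩
  rintro rfl
  exact hxy (map_zero _)

/-- Twice the distortion is not a restricted root. -/
theorem two_smul_distortion_notMem (hpos : IsPositivity pos) (hθ : IsCartanInvolution θ)
    (ha : IsCartanSubspace θ a) (hform : IsAlgebraicFormulation a pos h b δ)
    (hg0 : ¬ restrictedRootSpace a 0 ≤ h.toSubmodule) : (2 : ℝ) • δ ∉ restrictedRoots a := by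
  rintro ⟨-, hne⟩
  obtain ⟨f, hf, hf0⟩ := (Submodule.ne_bot_iff _).1 hne
  have hδ := hform.distortion_mem_restrictedRoots hθ ha hg0
  have hneg := hform.pos_neg_distortion hpos hθ ha hg0
  have hneg2 : pos (-((2 : ℝ) • δ)) := by
    have e : -((2 : ℝ) • δ) = (2 : ℝ) • -δ := by module
    exact e ▸ hpos.smul 2 _ two_pos hneg
  have hthree : ∀ x ∈ restrictedRootSpace a ((3 : ℝ) • δ), x = 0 := by
    have := ha.restrictedRootSpace_nsmul_eq_bot hθ hδ (n := 3) le_rfl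
    intro x hx
    rw [Nat.cast_ofNat] at this
    rwa [this, Submodule.mem_bot] at hx
  obtain ⟨A, hA⟩ := ha.exists_dual hθ δ
  have hAA := ha.dual_apply_self_pos hθ hδ.1 hA
  -- Skewness of `θ y`, of positive weight `-δ`, tested on `(y, y)`; `⁅θ y, y⁆` is a nonzero
  -- multiple of `A`.
  have hbA : ∀ y ∈ restrictedRootSpace a δ, b A y = 0 := by
    intro y hy
    by_cases hy0 : y = 0
    · rw [hy0, map_zero]
    have h1 := hform.lie_skew_adjoint hpos hθ ha hg0 hneg (ha.map_mem hy) y y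
    rw [hform.symm y, ← lie_skew, ha.lie_map_self hθ hA hy, map_neg, map_smul,
      LinearMap.neg_apply, LinearMap.smul_apply, smul_eq_mul] at h1
    have h2 : killingForm ℝ g y (θ y) * b A y = 0 := by linarith
    exact (mul_eq_zero.1 h2).resolve_left (hθ.killingForm_neg hy0).ne
  have hθf := ha.map_mem hf
  have hk := (hθ.killingForm_neg hf0).ne
  have hlie : ⁅f, θ f⁆ = (2 * killingForm ℝ g f (θ f)) • (A : g) := by
    rw [ha.lie_map_self hθ (A := (2 : ℝ) • A) (fun H => by simp [hA]) hf, Submodule.coe_smul,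
      smul_smul, mul_comm]
  set k := killingForm ℝ g f (θ f)
  have hlie' : ⁅θ f, f⁆ = -((2 * k) • (A : g)) := by rw [← lie_skew, hlie]
  have hc : 2 * k * δ A ≠ 0 := mul_ne_zero (mul_ne_zero two_ne_zero hk) hAA.ne'
  -- By weights only `w ∈ g_{-δ}` can pair with `f`. Skewness of `θ f` is tested on `(⁅f, w⁆, f)`:
  -- the second term is a multiple of `b ⁅f, w⁆ A = 0`, and `⁅θ f, ⁅f, w⁆⁆` is a nonzero multiple of
  -- `w`, since `⁅θ f, w⁆` has weight `-3δ`.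
  have hbf : ∀ v, b f v = 0 := by
    refine hform.apply_eq_zero_of_forall hθ ha (m := -δ) (by module) hf fun w hw => ?_
    have hfw : ⁅f, w⁆ ∈ restrictedRootSpace a δ := by
      convert! lie_mem_restrictedRootSpace hf hw using 2
      module
    have h0 : ⁅θ f, w⁆ = 0 := by
      have h1 : θ ⁅θ f, w⁆ ∈ restrictedRootSpace a ((3 : ℝ) • δ) := by
        convert! ha.map_mem (lie_mem_restrictedRootSpace hθf hw) using 2
        module
      simpa using hthree _ h1
    have h1 : ⁅θ f, ⁅f, w⁆⁆ = (2 * k * δ A) • w := by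
      rw [leibniz_lie, h0, lie_zero, add_zero, hlie', neg_lie, smul_lie, hw A, smul_smul,
        ← neg_smul]
      simp
    have h2 := hform.lie_skew_adjoint hpos hθ ha hg0 hneg2 hθf ⁅f, w⁆ f
    rw [h1, hlie', map_neg, map_smul, map_smul, hform.symm _ (A : g), hbA _ hfw, smul_zero,
      neg_zero, add_zero, LinearMap.smul_apply, hform.symm w, smul_eq_mul] at h2
    exact (mul_eq_zero.1 h2).resolve_left hc
  obtain ⟨x, hx, y, hy, hxy⟩ := hform.exists_apply_ne_zero hθ ha hg0
  -- Contradiction from the skew element `⁅θ f, y⁆` tested on `(f, x)`: it maps `f` to a nonzero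
  -- multiple of `y`, while `f` is in the kernel of `b`, so `b x y = 0`.
  have hθfy : ⁅θ f, y⁆ ∈ restrictedRootSpace a (-δ) := by
    convert! lie_mem_restrictedRootSpace hθf hy using 2
    module
  have h0 : ⁅f, y⁆ = 0 := by
    refine hthree _ ?_
    convert! lie_mem_restrictedRootSpace hf hy using 2
    module
  have h1 : ⁅⁅θ f, y⁆, f⁆ = (-(2 * k * δ A)) • y := by
    rw [← lie_skew, leibniz_lie, h0, lie_zero, add_zero, hlie, smul_lie, hy A, smul_smul, neg_smul]
  have h2 := hform.lie_skew_adjoint hpos hθ ha hg0 hneg hθfy f x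
  rw [h1, hbf, add_zero, map_smul, LinearMap.smul_apply, hform.symm y, smul_eq_mul] at h2
  exact mul_ne_zero (neg_ne_zero.2 hc) hxy h2

end IsAlgebraicFormulation

/-! ### Traces of squares of symmetric and skew operators. -/

section PositiveDefinite

variable {V : Type*} [AddCommGroup V] [Module ℝ V] {β : LinearMap.BilinForm ℝ V}

theorem LinearMap.BilinForm.repr_eq_of_orthonormal {ι : Type*} [Fintype ι] [DecidableEq ι]
    (e : Module.Basis ι ℝ V) (he : ∀ i j, β (e i) (e j) = if i = j then 1 else 0) (x : V) (i : ι) :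
    e.repr x i = β (e i) x := by
  conv_rhs => rw [← e.sum_repr x, map_sum]
  simp only [map_smul, he]
  simp

theorem LinearMap.BilinForm.trace_eq_sum_of_orthonormal {ι : Type*} [Fintype ι] [DecidableEq ι]
    (e : Module.Basis ι ℝ V) (he : ∀ i j, β (e i) (e j) = if i = j then 1 else 0)
    (T : V →ₗ[ℝ] V) : LinearMap.trace ℝ V T = ∑ i, β (e i) (T (e i)) := by
  simp [LinearMap.trace_eq_matrix_trace ℝ e, Matrix.trace, LinearMap.toMatrix_apply,
    LinearMap.BilinForm.repr_eq_of_orthonormal e he]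

variable [FiniteDimensional ℝ V]

theorem LinearMap.BilinForm.exists_orthonormal_basis (hsymm : ∀ x y, β x y = β y x)
    (hpos : ∀ x, x ≠ 0 → 0 < β x x) :
    ∃ e : Module.Basis (Fin (Module.finrank ℝ V)) ℝ V,
      ∀ i j, β (e i) (e j) = if i = j then 1 else 0 := by
  let c : InnerProductSpace.Core ℝ V :=
    { inner := fun x y => β x y
      conj_inner_symm := fun x y => by simp [hsymm y x]
      re_inner_nonneg := fun x => by
        by_cases hx : x = 0
        · simp [hx]
        · exact (hpos x hx).le
      add_left := fun x y z => by simp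
      smul_left := fun x y r => by simp
      definite := fun x hx => by
        by_contra h
        exact (hpos x h).ne' hx }
  let : NormedAddCommGroup V := @InnerProductSpace.Core.toNormedAddCommGroup ℝ V _ _ _ c
  let : InnerProductSpace ℝ V := InnerProductSpace.ofCore c.toCore
  refine ⟨(stdOrthonormalBasis ℝ V).toBasis, fun i j => ?_⟩
  have := orthonormal_iff_ite.1 (stdOrthonormalBasis ℝ V).orthonormal i j
  rw [OrthonormalBasis.coe_toBasis]
  exact this

theorem LinearMap.BilinForm.trace_comp_self_nonneg (hsymm : ∀ x y, β x y = β y x)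
    (hpos : ∀ x, x ≠ 0 → 0 < β x x) {T : V →ₗ[ℝ] V} (hT : ∀ x y, β (T x) y = β x (T y)) :
    0 ≤ LinearMap.trace ℝ V (T ∘ₗ T) := by
  obtain ⟨e, he⟩ := LinearMap.BilinForm.exists_orthonormal_basis hsymm hpos
  rw [LinearMap.BilinForm.trace_eq_sum_of_orthonormal e he]
  refine Finset.sum_nonneg fun i _ => ?_
  rw [LinearMap.comp_apply, ← hT]
  by_cases h : T (e i) = 0
  · simp [h]
  · exact (hpos _ h).le

theorem LinearMap.BilinForm.trace_comp_self_neg (hsymm : ∀ x y, β x y = β y x)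
    (hpos : ∀ x, x ≠ 0 → 0 < β x x) {T : V →ₗ[ℝ] V} (hT : ∀ x y, β (T x) y = -β x (T y))
    (hT0 : T ≠ 0) : LinearMap.trace ℝ V (T ∘ₗ T) < 0 := by
  obtain ⟨e, he⟩ := LinearMap.BilinForm.exists_orthonormal_basis hsymm hpos
  obtain ⟨i, hi⟩ : ∃ i, T (e i) ≠ 0 := by
    by_contra! h
    exact hT0 (e.ext fun i => by simp [h])
  have key : ∀ i, β (e i) (T (T (e i))) = -β (T (e i)) (T (e i)) := fun i => by
    rw [hT, neg_neg]
  rw [LinearMap.BilinForm.trace_eq_sum_of_orthonormal e he]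
  refine Finset.sum_neg' (fun j _ => ?_) ⟨i, Finset.mem_univ _, ?_⟩
  · rw [LinearMap.comp_apply, key]
    by_cases h : T (e j) = 0
    · simp [h]
    · linarith [hpos _ h]
  · rw [LinearMap.comp_apply, key]
    linarith [hpos _ hi]

end PositiveDefinite

/-! ### Recognizing `so(1, N)` from a hyperbolic Lie triple system. -/

/-- The data of a Lie algebra whose `-1`-eigenspace under an involution `θ` has the orthonormal
basis `e` and carries the Lie triple product of hyperbolic space. -/
structure IsHyperbolicFrame {G : Type*} [LieRing G] [LieAlgebra ℝ G] {N : ℕ}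
    (κ : LinearMap.BilinForm ℝ G) (θ : G →ₗ⁅ℝ⁆ G) (e : Fin N → G) : Prop where
  symm : ∀ x y, κ x y = κ y x
  lie_left : ∀ x y z, κ ⁅x, y⁆ z = κ x ⁅y, z⁆
  involutive : ∀ x, θ (θ x) = x
  map_map : ∀ x y, κ (θ x) (θ y) = κ x y
  map_frame : ∀ i, θ (e i) = -e i
  orthonormal : ∀ i j, κ (e i) (e j) = if i = j then 1 else 0
  sum_frame : ∀ x, θ x = -x → ∑ i, κ x (e i) • e i = x
  triple : ∀ x y z, θ x = -x → θ y = -y → θ z = -z → ⁅⁅x, y⁆, z⁆ = κ y z • x - κ x z • y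
  faithful : ∀ x, θ x = x → (∀ i, ⁅x, e i⁆ = 0) → x = 0

namespace IsHyperbolicFrame

variable {G : Type*} [LieRing G] [LieAlgebra ℝ G] {N : ℕ}
  {κ : LinearMap.BilinForm ℝ G} {θ : G →ₗ⁅ℝ⁆ G} {e : Fin N → G}

/-- The matrix of the action of a Lie algebra element on `ℝ ⊕ span e`. -/
def toMatrix (κ : LinearMap.BilinForm ℝ G) (e : Fin N → G) :
    G →ₗ[ℝ] Matrix (Fin 1 ⊕ Fin N) (Fin 1 ⊕ Fin N) ℝ where
  toFun x := Matrix.fromBlocks 0 (Matrix.of fun _ j => κ x (e j)) (Matrix.of fun i _ => κ x (e i))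
    (Matrix.of fun i j => κ (e i) ⁅x, e j⁆)
  map_add' x y := by
    ext (i | i) (j | j) <;> simp
  map_smul' c x := by
    ext (i | i) (j | j) <;> simp

theorem apply_map_frame (hF : IsHyperbolicFrame κ θ e) (x : G) (i : Fin N) :
    κ (θ x) (e i) = -κ x (e i) := by
  rw [← hF.map_map, hF.involutive, hF.map_frame, map_neg]

theorem frame_apply_map (hF : IsHyperbolicFrame κ θ e) (x : G) (i : Fin N) :
    κ (e i) (θ x) = -κ (e i) x := by
  rw [hF.symm, hF.apply_map_frame, hF.symm]

/-- Parseval's identity on the `-1`-eigenspace, where `(x - θ x) / 2` is the component of `x`. -/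
theorem sum_apply_frame_mul (hF : IsHyperbolicFrame κ θ e) (x z : G) :
    ∑ i, κ x (e i) * κ (e i) z = (κ x z - κ (θ x) z) / 2 := by
  have h1 := hF.sum_frame (x - θ x) (by rw [map_sub, hF.involutive, neg_sub])
  have h2 := congrArg (fun w => κ w z) h1
  simp only [map_sum, map_smul, LinearMap.sum_apply, LinearMap.smul_apply, map_sub,
    LinearMap.sub_apply, hF.apply_map_frame, smul_eq_mul, sub_neg_eq_add, ← two_mul] at h2
  rw [← h2, Finset.sum_div]
  refine Finset.sum_congr rfl fun i _ => ?_
  ring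

theorem toMatrix_lie (hF : IsHyperbolicFrame κ θ e) (x y : G) :
    toMatrix κ e ⁅x, y⁆ = ⁅toMatrix κ e x, toMatrix κ e y⁆ := by
  have hrow : ∀ j, κ ⁅x, y⁆ (e j) = ∑ i, κ x (e i) * κ (e i) ⁅y, e j⁆
      - ∑ i, κ y (e i) * κ (e i) ⁅x, e j⁆ := by
    intro j
    rw [hF.sum_apply_frame_mul, hF.sum_apply_frame_mul, ← hF.lie_left, ← hF.lie_left,
      ← hF.lie_left, ← hF.lie_left]
    have h1 : κ ⁅θ x, y⁆ (e j) = -κ ⁅x, θ y⁆ (e j) := by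
      rw [← hF.apply_map_frame, LieHom.map_lie, hF.involutive]
    have h2 : κ ⁅y, x⁆ (e j) = -κ ⁅x, y⁆ (e j) := by
      rw [← lie_skew, map_neg, LinearMap.neg_apply]
    have h3 : κ ⁅θ y, x⁆ (e j) = -κ ⁅x, θ y⁆ (e j) := by
      rw [← lie_skew, map_neg, LinearMap.neg_apply]
    rw [h1, h2, h3]
    ring
  have hblock : ∀ i j, κ (e i) ⁅⁅x, y⁆, e j⁆ = κ x (e i) * κ y (e j) - κ y (e i) * κ x (e j)
      + (∑ k, κ (e i) ⁅x, e k⁆ * κ (e k) ⁅y, e j⁆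
      - ∑ k, κ (e i) ⁅y, e k⁆ * κ (e k) ⁅x, e j⁆) := by
    intro i j
    simp only [← hF.lie_left (e i)]
    rw [hF.sum_apply_frame_mul, hF.sum_apply_frame_mul]
    simp only [LieHom.map_lie, hF.map_frame, neg_lie, map_neg, LinearMap.neg_apply, hF.lie_left]
    have h1 : κ (e i) ⁅θ x, ⁅y, e j⁆⁆ = κ (e i) ⁅x, ⁅θ y, e j⁆⁆ := by
      rw [← neg_inj, ← hF.frame_apply_map]
      simp only [LieHom.map_lie, hF.involutive, hF.map_frame, lie_neg, map_neg]
    have h2 : κ (e i) ⁅x, ⁅θ y, e j⁆⁆ - κ (e i) ⁅θ y, ⁅x, e j⁆⁆ = κ (e i) ⁅⁅x, θ y⁆, e j⁆ := by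
      rw [lie_lie, map_sub]
    have h3 : κ (e i) ⁅x, ⁅y, e j⁆⁆ - κ (e i) ⁅y, ⁅x, e j⁆⁆ = κ (e i) ⁅⁅x, y⁆, e j⁆ := by
      rw [lie_lie, map_sub]
    -- Parseval recovers only half of `⁅⁅x, y⁆, e j⁆`, plus half of the mixed term with `θ y`. The
    -- triple product of the `-1`-components supplies the missing difference, which is the
    -- contribution of the first row and column.
    have h4 := hF.triple (x - θ x) (y - θ y) (e j) (by rw [map_sub, hF.involutive, neg_sub])
      (by rw [map_sub, hF.involutive, neg_sub]) (hF.map_frame j)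
    replace h4 := congrArg (κ (e i)) h4
    have h5 : κ (e i) ⁅⁅θ x, θ y⁆, e j⁆ = κ (e i) ⁅⁅x, y⁆, e j⁆ := by
      rw [← neg_inj, ← hF.frame_apply_map]
      simp only [LieHom.map_lie, hF.involutive, hF.map_frame, lie_neg, map_neg]
    have h6 : κ (e i) ⁅⁅θ x, y⁆, e j⁆ = κ (e i) ⁅⁅x, θ y⁆, e j⁆ := by
      rw [← neg_inj, ← hF.frame_apply_map]
      simp only [LieHom.map_lie, hF.involutive, hF.map_frame, lie_neg, map_neg]
    simp only [sub_lie, lie_sub, map_sub, map_smul, LinearMap.sub_apply, h5, h6,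
      hF.apply_map_frame, hF.frame_apply_map, smul_eq_mul] at h4
    rw [hF.symm (e i) x, hF.symm (e i) y] at h4
    linarith
  ext (i | i) (j | j)
  · simp [toMatrix, Ring.lie_def, Matrix.fromBlocks_multiply, Matrix.mul_apply, mul_comm]
  · simp [toMatrix, Ring.lie_def, Matrix.fromBlocks_multiply, Matrix.mul_apply, hrow]
  · have h := hrow i
    have e1 : ∀ u v : G, ∑ k, κ u (e k) * κ (e k) ⁅v, e i⁆ = -∑ k, κ (e i) ⁅v, e k⁆ * κ u (e k) := by
      intro u v
      rw [← Finset.sum_neg_distrib]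
      refine Finset.sum_congr rfl fun k _ => ?_
      rw [← hF.lie_left, ← lie_skew, map_neg, LinearMap.neg_apply, hF.symm (⁅v, e k⁆)]
      ring
    rw [e1, e1] at h
    simp [toMatrix, Ring.lie_def, Matrix.fromBlocks_multiply, Matrix.mul_apply, h]
    ring
  · simp [toMatrix, Ring.lie_def, Matrix.fromBlocks_multiply, Matrix.mul_apply, hblock,
      -lie_lie]
    ring

theorem mem_so'_iff {A : Matrix (Fin 1 ⊕ Fin N) (Fin 1 ⊕ Fin N) ℝ} :
    A ∈ LieAlgebra.Orthogonal.so' (Fin 1) (Fin N) ℝ ↔ A (Sum.inl 0) (Sum.inl 0) = 0 ∧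
      (∀ i, A (Sum.inr i) (Sum.inl 0) = A (Sum.inl 0) (Sum.inr i)) ∧
      ∀ i j, A (Sum.inr i) (Sum.inr j) = -A (Sum.inr j) (Sum.inr i) := by
  rw [LieAlgebra.Orthogonal.so', mem_skewAdjointMatricesLieSubalgebra,
    mem_skewAdjointMatricesSubmodule, Matrix.IsSkewAdjoint, Matrix.IsAdjointPair,
    LieAlgebra.Orthogonal.indefiniteDiagonal, ← Matrix.ext_iff]
  simp only [Matrix.mul_diagonal, Matrix.diagonal_mul, Matrix.transpose_apply, Matrix.neg_apply,
    Sum.forall, Sum.elim_inl, Sum.elim_inr, Fin.forall_fin_one]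
  constructor
  · rintro ⟨⟨h1, h2⟩, h3⟩
    refine ⟨by linarith, fun i => by linarith [h2 i], fun i j => by linarith [(h3 j).2 i]⟩
  · rintro ⟨h1, h2, h3⟩
    refine ⟨⟨by linarith, fun i => by linarith [h2 i]⟩, fun i => ⟨by linarith [h2 i],
      fun j => by linarith [h3 i j]⟩⟩

theorem toMatrix_mem_so' (hF : IsHyperbolicFrame κ θ e) (x : G) :
    toMatrix κ e x ∈ LieAlgebra.Orthogonal.so' (Fin 1) (Fin N) ℝ := by
  refine mem_so'_iff.2 ⟨by simp [toMatrix], by simp [toMatrix], fun i j => ?_⟩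
  simp only [toMatrix, LinearMap.coe_mk, AddHom.coe_mk, Matrix.fromBlocks_apply₂₂, Matrix.of_apply]
  rw [← hF.lie_left, ← lie_skew, map_neg, LinearMap.neg_apply, hF.symm]

/-- The matrix representation as a Lie algebra homomorphism to `so(1, N)`. -/
def toSo' (hF : IsHyperbolicFrame κ θ e) : G →ₗ⁅ℝ⁆ LieAlgebra.Orthogonal.so' (Fin 1) (Fin N) ℝ where
  toFun x := ⟨toMatrix κ e x, hF.toMatrix_mem_so' x⟩
  map_add' x y := Subtype.ext (map_add _ x y)
  map_smul' c x := Subtype.ext (map_smul _ c x)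
  map_lie' {x y} := Subtype.ext (hF.toMatrix_lie x y)

/-- A zero first row kills the `-1`-component, so `θ x = x`; a zero lower block then makes `x`
centralize the frame. -/
theorem toSo'_injective (hF : IsHyperbolicFrame κ θ e) : Function.Injective hF.toSo' := by
  rw [injective_iff_map_eq_zero]
  intro x hx
  replace hx : toMatrix κ e x = 0 := congrArg Subtype.val hx
  have hrow : ∀ i, κ x (e i) = 0 := fun i => congrFun (congrFun hx (Sum.inl 0)) (Sum.inr i)
  have hblock : ∀ i j, κ (e i) ⁅x, e j⁆ = 0 := fun i j =>
    congrFun (congrFun hx (Sum.inr i)) (Sum.inr j)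
  have hfix : θ x = x := by
    have := hF.sum_frame (x - θ x) (by rw [map_sub, hF.involutive, neg_sub])
    simp only [map_sub, LinearMap.sub_apply, hF.apply_map_frame, hrow, neg_zero, sub_zero,
      zero_smul, Finset.sum_const_zero] at this
    exact (sub_eq_zero.1 this.symm).symm
  refine hF.faithful x hfix fun j => ?_
  rw [← hF.sum_frame ⁅x, e j⁆ (by rw [LieHom.map_lie, hfix, hF.map_frame, lie_neg])]
  refine Finset.sum_eq_zero fun i _ => ?_
  rw [hF.symm, hblock, zero_smul]

theorem toSo'_surjective (hF : IsHyperbolicFrame κ θ e) : Function.Surjective hF.toSo' := by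
  rintro ⟨A, hA⟩
  obtain ⟨h0, hrow, hblock⟩ := mem_so'_iff.1 hA
  have hkp : ∀ i j k, κ ⁅e i, e j⁆ (e k) = 0 := by
    intro i j k
    have := hF.apply_map_frame ⁅e i, e j⁆ k
    rw [LieHom.map_lie, hF.map_frame, hF.map_frame, neg_lie, lie_neg, neg_neg] at this
    linarith
  have hpk : ∀ i j k, κ (e k) ⁅e i, e j⁆ = 0 := fun i j k => by rw [hF.symm, hkp]
  have htr : ∀ i j k l, κ (e k) ⁅⁅e i, e j⁆, e l⁆
      = (if j = l then 1 else 0) * (if k = i then 1 else 0)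
        - (if i = l then 1 else 0) * (if k = j then 1 else 0) := by
    intro i j k l
    rw [hF.triple _ _ _ (hF.map_frame _) (hF.map_frame _) (hF.map_frame _), map_sub, map_smul,
      map_smul, hF.orthonormal, hF.orthonormal, hF.orthonormal, hF.orthonormal, smul_eq_mul,
      smul_eq_mul]
  -- The `e i` produce the boost entries, and `⁅e i, e j⁆` has lower block `E_ij - E_ji`. The factor
  -- `1 / 2` compensates for counting each pair twice.
  refine ⟨∑ i, A (Sum.inl 0) (Sum.inr i) • e i
    + (1 / 2 : ℝ) • ∑ i, ∑ j, A (Sum.inr i) (Sum.inr j) • ⁅e i, e j⁆, Subtype.ext ?_⟩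
  change toMatrix κ e _ = A
  have hr : ∀ k, κ (∑ i, A (Sum.inl 0) (Sum.inr i) • e i
      + (1 / 2 : ℝ) • ∑ i, ∑ j, A (Sum.inr i) (Sum.inr j) • ⁅e i, e j⁆) (e k)
      = A (Sum.inl 0) (Sum.inr k) := by
    intro k
    simp [LinearMap.sum_apply, hF.orthonormal, hkp]
  have hb : ∀ k l, κ (e k) ⁅∑ i, A (Sum.inl 0) (Sum.inr i) • e i
      + (1 / 2 : ℝ) • ∑ i, ∑ j, A (Sum.inr i) (Sum.inr j) • ⁅e i, e j⁆, e l⁆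
      = A (Sum.inr k) (Sum.inr l) := by
    intro k l
    have := hblock k l
    simp [-lie_lie, sum_lie, htr, hpk, mul_sub, Finset.sum_sub_distrib]
    linarith
  ext (i | i) (j | j)
  · obtain rfl := Subsingleton.elim i 0
    obtain rfl := Subsingleton.elim j 0
    simp [toMatrix, h0]
  · obtain rfl := Subsingleton.elim i 0
    exact hr j
  · obtain rfl := Subsingleton.elim j 0
    exact (hr i).trans (hrow i).symm
  · exact hb i j

theorem nonempty_lieEquiv_so' (hF : IsHyperbolicFrame κ θ e) :
    Nonempty (G ≃ₗ⁅ℝ⁆ LieAlgebra.Orthogonal.so' (Fin 1) (Fin N) ℝ) :=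
  ⟨LieEquiv.ofBijective hF.toSo' ⟨hF.toSo'_injective, hF.toSo'_surjective⟩⟩

end IsHyperbolicFrame

/-! ### The span of `g_{±δ}` and their brackets, and its triple product. -/

section RankOne

variable {g : Type*} [LieRing g] [LieAlgebra ℝ g] {θ : g ≃ₗ⁅ℝ⁆ g} {a : Submodule ℝ g}
  {δ : Module.Dual ℝ a}

/-- The span of the root spaces `g_δ`, `g_{-δ}` and their brackets. -/
def rankOneSubmodule (a : Submodule ℝ g) (δ : Module.Dual ℝ a) : Submodule ℝ g :=
  restrictedRootSpace a δ ⊔ restrictedRootSpace a (-δ) ⊔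
    Submodule.span ℝ
      {w | ∃ u ∈ restrictedRootSpace a δ, ∃ v ∈ restrictedRootSpace a (-δ), ⁅u, v⁆ = w}

theorem mem_rankOneSubmodule_of_mem {u : g} (hu : u ∈ restrictedRootSpace a δ) :
    u ∈ rankOneSubmodule a δ :=
  Submodule.mem_sup_left (Submodule.mem_sup_left hu)

theorem mem_rankOneSubmodule_of_mem_neg {v : g} (hv : v ∈ restrictedRootSpace a (-δ)) :
    v ∈ rankOneSubmodule a δ :=
  Submodule.mem_sup_left (Submodule.mem_sup_right hv)

theorem lie_mem_rankOneSubmodule_of_mem {u v : g} (hu : u ∈ restrictedRootSpace a δ)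
    (hv : v ∈ restrictedRootSpace a (-δ)) : ⁅u, v⁆ ∈ rankOneSubmodule a δ :=
  Submodule.mem_sup_right (Submodule.subset_span ⟨u, hu, v, hv, rfl⟩)

theorem rankOneSubmodule_le {P : Submodule ℝ g} (h1 : ∀ u ∈ restrictedRootSpace a δ, u ∈ P)
    (h2 : ∀ v ∈ restrictedRootSpace a (-δ), v ∈ P)
    (h3 : ∀ u ∈ restrictedRootSpace a δ, ∀ v ∈ restrictedRootSpace a (-δ), ⁅u, v⁆ ∈ P) :
    rankOneSubmodule a δ ≤ P := by
  refine sup_le (sup_le h1 h2) (Submodule.span_le.2 ?_)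
  rintro _ ⟨u, hu, v, hv, rfl⟩
  exact h3 u hu v hv

theorem lie_mem_restrictedRootSpace_zero {u v : g} (hu : u ∈ restrictedRootSpace a δ)
    (hv : v ∈ restrictedRootSpace a (-δ)) : ⁅u, v⁆ ∈ restrictedRootSpace a 0 := by
  simpa using lie_mem_restrictedRootSpace hu hv

theorem lie_mem_of_mem_zero {α : Module.Dual ℝ a} {z u : g} (hz : z ∈ restrictedRootSpace a 0)
    (hu : u ∈ restrictedRootSpace a α) : ⁅z, u⁆ ∈ restrictedRootSpace a α := by
  simpa using lie_mem_restrictedRootSpace hz hu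

theorem lie_eq_zero_of_two_smul (h2 : restrictedRootSpace a ((2 : ℝ) • δ) = ⊥) {u v : g}
    (hu : u ∈ restrictedRootSpace a δ) (hv : v ∈ restrictedRootSpace a δ) : ⁅u, v⁆ = 0 := by
  have := lie_mem_restrictedRootSpace hu hv
  rw [← two_smul ℝ, h2] at this
  simpa using this

theorem IsCartanSubspace.restrictedRootSpace_neg_eq_bot (ha : IsCartanSubspace θ a)
    {α : Module.Dual ℝ a} (h : restrictedRootSpace a α = ⊥) : restrictedRootSpace a (-α) = ⊥ := by
  rw [Submodule.eq_bot_iff]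
  intro x hx
  have := ha.map_mem hx
  rw [neg_neg, h] at this
  simpa using this

theorem IsCartanSubspace.map_mem_of_neg (ha : IsCartanSubspace θ a) {x : g}
    (hx : x ∈ restrictedRootSpace a (-δ)) : θ x ∈ restrictedRootSpace a δ := by
  simpa using ha.map_mem hx

theorem IsCartanSubspace.lie_neg_eq_zero (ha : IsCartanSubspace θ a)
    (h2 : restrictedRootSpace a ((2 : ℝ) • δ) = ⊥) {u v : g}
    (hu : u ∈ restrictedRootSpace a (-δ)) (hv : v ∈ restrictedRootSpace a (-δ)) : ⁅u, v⁆ = 0 := by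
  have := lie_eq_zero_of_two_smul h2 (ha.map_mem_of_neg hu) (ha.map_mem_of_neg hv)
  rw [← LieEquiv.map_lie] at this
  simpa using this

/-- The span is stable because `g_0` preserves `g_{±δ}`, the brackets `⁅g_δ, g_{-δ}⁆` lie in `g_0`,
and each of `g_δ`, `g_{-δ}` is abelian when `g_{2δ}` vanishes. -/
theorem IsCartanSubspace.lie_mem_rankOneSubmodule (ha : IsCartanSubspace θ a)
    (h2 : restrictedRootSpace a ((2 : ℝ) • δ) = ⊥) {x y : g}
    (hx : x ∈ restrictedRootSpace a 0 ⊔ restrictedRootSpace a δ ⊔ restrictedRootSpace a (-δ))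
    (hy : y ∈ rankOneSubmodule a δ) : ⁅x, y⁆ ∈ rankOneSubmodule a δ := by
  obtain ⟨_, hzu, v, hv, rfl⟩ := Submodule.mem_sup.1 hx
  obtain ⟨z, hz, u, hu, rfl⟩ := Submodule.mem_sup.1 hzu
  have key : ∀ w : g, (∀ p ∈ restrictedRootSpace a δ, ⁅w, p⁆ ∈ rankOneSubmodule a δ) →
      (∀ p ∈ restrictedRootSpace a (-δ), ⁅w, p⁆ ∈ rankOneSubmodule a δ) →
      (∀ p ∈ restrictedRootSpace a δ, ∀ q ∈ restrictedRootSpace a (-δ),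
        ⁅w, ⁅p, q⁆⁆ ∈ rankOneSubmodule a δ) → ⁅w, y⁆ ∈ rankOneSubmodule a δ := by
    intro w e1 e2 e3
    exact rankOneSubmodule_le
      (P := (rankOneSubmodule a δ).comap (LieAlgebra.ad ℝ g w : g →ₗ[ℝ] g)) e1 e2 e3 hy
  rw [add_lie, add_lie]
  refine add_mem (add_mem (key z ?_ ?_ ?_) (key u ?_ ?_ ?_)) (key v ?_ ?_ ?_)
  · exact fun p hp => mem_rankOneSubmodule_of_mem (lie_mem_of_mem_zero hz hp)
  · exact fun p hp => mem_rankOneSubmodule_of_mem_neg (lie_mem_of_mem_zero hz hp)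
  · intro p hp q hq
    rw [leibniz_lie]
    exact add_mem (lie_mem_rankOneSubmodule_of_mem (lie_mem_of_mem_zero hz hp) hq)
      (lie_mem_rankOneSubmodule_of_mem hp (lie_mem_of_mem_zero hz hq))
  · intro p hp
    rw [lie_eq_zero_of_two_smul h2 hu hp]
    exact zero_mem _
  · exact fun p hp => lie_mem_rankOneSubmodule_of_mem hu hp
  · intro p hp q hq
    rw [← lie_skew]
    exact neg_mem (mem_rankOneSubmodule_of_mem
      (lie_mem_of_mem_zero (lie_mem_restrictedRootSpace_zero hp hq) hu))
  · intro p hp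
    rw [← lie_skew]
    exact neg_mem (lie_mem_rankOneSubmodule_of_mem hp hv)
  · intro p hp
    rw [ha.lie_neg_eq_zero h2 hv hp]
    exact zero_mem _
  · intro p hp q hq
    rw [← lie_skew]
    exact neg_mem (mem_rankOneSubmodule_of_mem_neg
      (lie_mem_of_mem_zero (lie_mem_restrictedRootSpace_zero hp hq) hv))

theorem rankOneSubmodule_le_sup : rankOneSubmodule a δ ≤
    restrictedRootSpace a 0 ⊔ restrictedRootSpace a δ ⊔ restrictedRootSpace a (-δ) :=
  rankOneSubmodule_le (fun _ hu => Submodule.mem_sup_left (Submodule.mem_sup_right hu))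
    (fun _ hv => Submodule.mem_sup_right hv)
    (fun _ hu _ hv => Submodule.mem_sup_left (Submodule.mem_sup_left
      (lie_mem_restrictedRootSpace_zero hu hv)))

theorem IsCartanSubspace.map_mem_rankOneSubmodule (ha : IsCartanSubspace θ a) {x : g}
    (hx : x ∈ rankOneSubmodule a δ) : θ x ∈ rankOneSubmodule a δ := by
  refine rankOneSubmodule_le (P := (rankOneSubmodule a δ).comap (θ : g →ₗ[ℝ] g))
    (fun u hu => ?_) (fun v hv => ?_) (fun u hu v hv => ?_) hx
  · exact mem_rankOneSubmodule_of_mem_neg (ha.map_mem hu)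
  · exact mem_rankOneSubmodule_of_mem (ha.map_mem_of_neg hv)
  · change θ ⁅u, v⁆ ∈ rankOneSubmodule a δ
    rw [LieEquiv.map_lie, ← lie_skew]
    exact neg_mem (lie_mem_rankOneSubmodule_of_mem (ha.map_mem_of_neg hv) (ha.map_mem hu))

variable [FiniteDimensional ℝ g]

theorem IsCartanSubspace.rootMultiples_subset (hθ : IsCartanInvolution θ)
    (ha : IsCartanSubspace θ a) (hδ : δ ∈ restrictedRoots a)
    (h2 : restrictedRootSpace a ((2 : ℝ) • δ) = ⊥) : rootMultiples a δ ⊆ {δ, -δ} := by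
  rintro _ ⟨⟨h0, hne⟩, m, rfl⟩
  have hnat : ∀ k : ℕ, 2 ≤ k → restrictedRootSpace a ((k : ℝ) • δ) = ⊥ := by
    intro k hk
    rcases hk.eq_or_lt with rfl | hk
    · exact_mod_cast h2
    · exact ha.restrictedRootSpace_nsmul_eq_bot hθ hδ hk
  obtain ⟨k, rfl | rfl⟩ := m.eq_nat_or_neg
  · rcases lt_or_ge k 2 with hk | hk
    · interval_cases k
      · simp at h0
      · simp
    · refine absurd ?_ hne
      rw [natCast_zsmul, ← Nat.cast_smul_eq_nsmul ℝ]
      exact hnat k hk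
  · rcases lt_or_ge k 2 with hk | hk
    · interval_cases k
      · simp at h0
      · simp
    · refine absurd ?_ hne
      rw [neg_smul, natCast_zsmul, ← Nat.cast_smul_eq_nsmul ℝ]
      exact ha.restrictedRootSpace_neg_eq_bot (hnat k hk)

theorem IsCartanSubspace.toSubmodule_multiplesSubalgebra (hθ : IsCartanInvolution θ)
    (ha : IsCartanSubspace θ a) (hδ : δ ∈ restrictedRoots a)
    (h2 : restrictedRootSpace a ((2 : ℝ) • δ) = ⊥) :
    (multiplesSubalgebra a δ).toSubmodule =
      restrictedRootSpace a 0 ⊔ restrictedRootSpace a δ ⊔ restrictedRootSpace a (-δ) := by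
  have hδ' : -δ ∈ restrictedRoots a := by
    refine ⟨neg_ne_zero.2 hδ.1, fun h => hδ.2 ?_⟩
    simpa using ha.restrictedRootSpace_neg_eq_bot h
  have hset : rootMultiples a δ = {δ, -δ} := by
    refine (ha.rootMultiples_subset hθ hδ h2).antisymm ?_
    rintro _ (rfl | rfl)
    · exact ⟨hδ, 1, by simp⟩
    · exact ⟨hδ', -1, by simp⟩
  change rootSubmodule a (rootMultiples a δ) = _
  rw [rootSubmodule, hset, iSup_insert, iSup_singleton, sup_assoc]

/-- The Lie triple product on the `-1`-eigenspace of the rank one subalgebra is that of a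
hyperbolic space. -/
theorem IsCartanSubspace.lie_triple (hθ : IsCartanInvolution θ) (ha : IsCartanSubspace θ a)
    (h2 : restrictedRootSpace a ((2 : ℝ) • δ) = ⊥) {A : a}
    (hA : ∀ H : a, killingForm ℝ g A H = δ H) (hδ : δ ≠ 0) {u v w : g}
    (hu : u ∈ restrictedRootSpace a δ) (hv : v ∈ restrictedRootSpace a δ)
    (hw : w ∈ restrictedRootSpace a δ) (r s t : ℝ) :
    ⁅⁅r • (A : g) + (u - θ u), s • (A : g) + (v - θ v)⁆, t • (A : g) + (w - θ w)⁆ =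
      (δ A * killingForm ℝ g (s • (A : g) + (v - θ v)) (t • (A : g) + (w - θ w))) •
        (r • (A : g) + (u - θ u)) -
      (δ A * killingForm ℝ g (r • (A : g) + (u - θ u)) (t • (A : g) + (w - θ w))) •
        (s • (A : g) + (v - θ v)) := by
  have hAl : ∀ p ∈ restrictedRootSpace a δ, ⁅(A : g), p⁆ = δ A • p := fun p hp => hp A
  have hAr : ∀ p ∈ restrictedRootSpace a δ, ⁅p, (A : g)⁆ = -(δ A • p) := fun p hp => by
    rw [← lie_skew, hAl p hp]
  have hAθl : ∀ p ∈ restrictedRootSpace a δ, ⁅(A : g), θ p⁆ = -(δ A • θ p) := fun p hp => by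
    rw [ha.map_mem hp A, LinearMap.neg_apply, neg_smul]
  have hAθr : ∀ p ∈ restrictedRootSpace a δ, ⁅θ p, (A : g)⁆ = δ A • θ p := fun p hp => by
    rw [← lie_skew, hAθl p hp, neg_neg]
  have hθA : θ (A : g) = -A := ha.neg _ A.2
  have hpp : ∀ p ∈ restrictedRootSpace a δ, ∀ q ∈ restrictedRootSpace a δ, ⁅p, q⁆ = 0 :=
    fun p hp q hq => lie_eq_zero_of_two_smul h2 hp hq
  have hθpp : ∀ p ∈ restrictedRootSpace a δ, ∀ q ∈ restrictedRootSpace a δ, ⁅θ p, θ q⁆ = 0 :=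
    fun p hp q hq => by rw [← LieEquiv.map_lie, hpp p hp q hq, map_zero]
  have hsym : ∀ p q, killingForm ℝ g p (θ q) = killingForm ℝ g q (θ p) := fun p q => by
    rw [hθ.killingForm_map_right, killingForm_comm]
  have hlie : ∀ p ∈ restrictedRootSpace a δ, ∀ q ∈ restrictedRootSpace a δ,
      ⁅p, θ q⁆ + ⁅q, θ p⁆ = (2 * killingForm ℝ g p (θ q)) • (A : g) :=
    fun p hp q hq => ha.lie_map_add_lie_map hθ hA hp hq
  have hT1 : ∀ p ∈ restrictedRootSpace a δ, ∀ q ∈ restrictedRootSpace a δ,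
      ∀ x ∈ restrictedRootSpace a δ, ⁅⁅p, θ q⁆, x⁆ =
        (2 * killingForm ℝ g p (θ q) * δ A) • x - ⁅⁅q, θ p⁆, x⁆ := by
    intro p hp q hq x hx
    rw [eq_sub_iff_add_eq, ← add_lie, hlie p hp q hq, smul_lie, hAl x hx, smul_smul]
  have hT2 : ∀ p ∈ restrictedRootSpace a δ, ∀ q ∈ restrictedRootSpace a δ,
      ∀ x ∈ restrictedRootSpace a δ, ⁅⁅p, θ q⁆, x⁆ = ⁅⁅x, θ q⁆, p⁆ := by
    intro p hp q hq x hx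
    rw [lie_lie, hpp p hp x hx, lie_zero, sub_zero, ← lie_skew ⁅x, θ q⁆, ← lie_skew x, lie_neg,
      neg_neg]
  -- `⁅⁅p, θ q⁆, x⁆` is symmetric in `p, x` (`hT2`) and antisymmetric in `p, q` up to a known
  -- multiple of `x` (`hT1`). Alternating the two swaps three times returns to the original term
  -- with opposite sign, so the accumulated corrections equal twice that term.
  have hT : ∀ p ∈ restrictedRootSpace a δ, ∀ q ∈ restrictedRootSpace a δ,
      ∀ x ∈ restrictedRootSpace a δ, ⁅⁅p, θ q⁆, x⁆ =
        (δ A * killingForm ℝ g p (θ q)) • x - (δ A * killingForm ℝ g p (θ x)) • q +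
        (δ A * killingForm ℝ g q (θ x)) • p := by
    intro p hp q hq x hx
    have e1 := hT2 p hp q hq x hx
    have e2 := hT1 x hx q hq p hp
    have e3 := hT2 q hq x hx p hp
    have e4 := hT1 p hp x hx q hq
    have e5 := hT2 x hx p hp q hq
    have e6 := hT1 q hq p hp x hx
    rw [hsym x q] at e2
    rw [hsym q p] at e6
    have e7 : (2 : ℝ) • ⁅⁅p, θ q⁆, x⁆ = (2 : ℝ) •
        ((δ A * killingForm ℝ g p (θ q)) • x - (δ A * killingForm ℝ g p (θ x)) • q +
        (δ A * killingForm ℝ g q (θ x)) • p) := by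
      rw [two_smul]
      nth_rewrite 1 [e1]
      rw [e2, e3, e4, e5, e6]
      module
    exact smul_right_injective g (two_ne_zero (α := ℝ)) e7
  -- The element `⁅v, θ u⁆ - ⁅u, θ v⁆` is fixed by `θ` and commutes with `A`. It acts as an
  -- infinitesimal rotation in the plane of `u` and `v`, and through `θ` in the same way on
  -- `g_{-δ}`.
  have hD : ∀ x ∈ restrictedRootSpace a δ, ⁅⁅v, θ u⁆ - ⁅u, θ v⁆, x⁆ =
      (2 * δ A * killingForm ℝ g u (θ x)) • v - (2 * δ A * killingForm ℝ g v (θ x)) • u := by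
    intro x hx
    rw [sub_lie, hT v hv u hu x hx, hT u hu v hv x hx, hsym v u]
    module
  have hDθ : ⁅⁅v, θ u⁆ - ⁅u, θ v⁆, θ w⁆ =
      (2 * δ A * killingForm ℝ g u (θ w)) • θ v - (2 * δ A * killingForm ℝ g v (θ w)) • θ u := by
    have e := congrArg θ (hD w hw)
    rw [LieEquiv.map_lie, map_sub, LieEquiv.map_lie, LieEquiv.map_lie, hθ.involutive,
      hθ.involutive, ← lie_skew (θ v), ← lie_skew (θ u), map_sub, map_smul, map_smul] at e
    rw [← e]
    congr 1
    abel
  have hDA : ⁅⁅v, θ u⁆ - ⁅u, θ v⁆, (A : g)⁆ = 0 := by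
    have e : ⁅v, θ u⁆ - ⁅u, θ v⁆ ∈ restrictedRootSpace a 0 :=
      sub_mem (lie_mem_restrictedRootSpace_zero hv (ha.map_mem hu))
        (lie_mem_restrictedRootSpace_zero hu (ha.map_mem hv))
    rw [← lie_skew, e A, LinearMap.zero_apply, zero_smul, neg_zero]
  have hXY : ⁅r • (A : g) + (u - θ u), s • (A : g) + (v - θ v)⁆ =
      (r * δ A) • (v + θ v) - (s * δ A) • (u + θ u) + (⁅v, θ u⁆ - ⁅u, θ v⁆) := by
    simp only [add_lie, lie_add, sub_lie, lie_sub, smul_lie, lie_smul, lie_self, hAl v hv,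
      hAθl v hv, hAr u hu, hAθr u hu, hpp u hu v hv, hθpp u hu v hv]
    rw [← lie_skew (θ u) v]
    module
  have hKA : ∀ p ∈ restrictedRootSpace a δ, killingForm ℝ g (A : g) p = 0 := by
    intro p hp
    refine killingForm_eq_zero_of_add_ne_zero (α := 0) (fun H => ?_) hp (by simpa using hδ)
    simpa using ha.abelian _ H.2 _ A.2
  have hKAθ : ∀ p ∈ restrictedRootSpace a δ, killingForm ℝ g (A : g) (θ p) = 0 := by
    intro p hp
    rw [hθ.killingForm_map_right, hθA, map_neg, LinearMap.neg_apply, hKA p hp, neg_zero]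
  have hKpp : ∀ p ∈ restrictedRootSpace a δ, ∀ q ∈ restrictedRootSpace a δ,
      killingForm ℝ g p q = 0 := by
    intro p hp q hq
    refine killingForm_eq_zero_of_add_ne_zero hp hq ?_
    rw [← two_smul ℝ]
    exact smul_ne_zero two_ne_zero hδ
  have hK : ∀ p ∈ restrictedRootSpace a δ, ∀ q ∈ restrictedRootSpace a δ, ∀ m n : ℝ,
      killingForm ℝ g (m • (A : g) + (p - θ p)) (n • (A : g) + (q - θ q)) =
        m * n * δ A - 2 * killingForm ℝ g p (θ q) := by
    intro p hp q hq m n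
    simp only [map_add, map_sub, map_smul, LinearMap.add_apply, LinearMap.sub_apply,
      LinearMap.smul_apply, hKA q hq, hKAθ q hq, killingForm_comm p (A : g),
      killingForm_comm (θ p) (A : g), hKA p hp, hKAθ p hp, hKpp p hp q hq, hA,
      ← hθ.killingForm_map_right, hθ.involutive, smul_eq_mul]
    ring
  rw [hXY, hK v hv w hw, hK u hu w hw]
  have hvw : ∀ p ∈ restrictedRootSpace a δ, ⁅p + θ p, t • (A : g) + (w - θ w)⁆ =
      -((t * δ A) • (p - θ p)) - (2 * killingForm ℝ g p (θ w)) • (A : g) := by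
    intro p hp
    rw [← hlie p hp w hw]
    simp only [add_lie, lie_add, lie_sub, lie_smul, hAr p hp, hAθr p hp, hpp p hp w hw,
      hθpp p hp w hw]
    rw [← lie_skew (θ p) w]
    module
  rw [add_lie, sub_lie, smul_lie, smul_lie, hvw v hv, hvw u hu, lie_add, lie_smul, hDA, lie_sub,
    hD w hw, hDθ]
  module

end RankOne

/-! ### The `-1`-eigenspace of the rank one subalgebra, and its simplicity. -/

section RankOneIdeal

variable {g : Type*} [LieRing g] [LieAlgebra ℝ g] {θ : g ≃ₗ⁅ℝ⁆ g} {a : Submodule ℝ g}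
  {δ : Module.Dual ℝ a}

/-- The map `(s, u) ↦ s A + (u - θ u)` parametrizing the `-1`-eigenspace of the rank one
subalgebra. -/
def rankOneParam (θ : g ≃ₗ⁅ℝ⁆ g) (A : a) (δ : Module.Dual ℝ a) :
    ℝ × restrictedRootSpace a δ →ₗ[ℝ] g where
  toFun p := p.1 • (A : g) + ((p.2 : g) - θ p.2)
  map_add' p q := by
    simp only [Prod.fst_add, Prod.snd_add, Submodule.coe_add, map_add]
    module
  map_smul' c p := by
    simp only [Prod.smul_fst, Prod.smul_snd, Submodule.coe_smul, map_smul, RingHom.id_apply,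
      smul_eq_mul]
    module

theorem rankOneParam_apply (A : a) (p : ℝ × restrictedRootSpace a δ) :
    rankOneParam θ A δ p = p.1 • (A : g) + ((p.2 : g) - θ p.2) := rfl

theorem IsCartanSubspace.map_rankOneParam (hθ : IsCartanInvolution θ) (ha : IsCartanSubspace θ a)
    (A : a) (p : ℝ × restrictedRootSpace a δ) :
    θ (rankOneParam θ A δ p) = -rankOneParam θ A δ p := by
  rw [rankOneParam_apply, map_add, map_smul, ha.neg _ A.2, map_sub, hθ.involutive]
  module

theorem IsCartanSubspace.lie_rankOneParam (ha : IsCartanSubspace θ a) (A : a)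
    (p : ℝ × restrictedRootSpace a δ) :
    ⁅(A : g), rankOneParam θ A δ p⁆ = δ A • ((p.2 : g) + θ p.2) := by
  rw [rankOneParam_apply, lie_add, lie_smul, lie_self, lie_sub, p.2.2 A, ha.map_mem p.2.2 A]
  simp only [LinearMap.neg_apply]
  module

theorem IsCartanSubspace.rankOneParam_injective (ha : IsCartanSubspace θ a) {A : a} (hA : 0 < δ A) :
    Function.Injective (rankOneParam θ A δ) := by
  rw [← LinearMap.ker_eq_bot, LinearMap.ker_eq_bot']
  intro p hp
  have h1 := ha.lie_rankOneParam A p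
  rw [hp, lie_zero, eq_comm, smul_eq_zero_iff_right hA.ne'] at h1
  have h2 := ha.lie_rankOneParam A p
  have h3 : ⁅(A : g), (p.2 : g) + θ p.2⁆ = δ A • ((p.2 : g) - θ p.2) := by
    rw [lie_add, p.2.2 A, ha.map_mem p.2.2 A]
    simp only [LinearMap.neg_apply]
    module
  rw [h1, lie_zero, eq_comm, smul_eq_zero_iff_right hA.ne'] at h3
  have h4 : (p.2 : g) = 0 := by
    have : (2 : ℝ) • (p.2 : g) = 0 := by
      rw [two_smul]
      nth_rewrite 1 [eq_neg_of_add_eq_zero_left h1]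
      nth_rewrite 2 [sub_eq_zero.1 h3]
      simp
    simpa using this
  have h5 : p.2 = 0 := Subtype.ext h4
  rw [rankOneParam_apply, h5] at hp
  have h6 : (A : g) ≠ 0 := by
    intro h
    have : A = 0 := Subtype.ext h
    simp [this] at hA
  have h7 : p.1 = 0 := by simpa [h6] using hp
  exact Prod.ext h7 h5

theorem mem_restrictedRootSpace_zero_of_lie_eq_zero {A : a} (hAA : 0 < δ A)
    {x : g} (hx : x ∈ restrictedRootSpace a 0 ⊔ restrictedRootSpace a δ ⊔
      restrictedRootSpace a (-δ)) (h : ⁅(A : g), x⁆ = 0) : x ∈ restrictedRootSpace a 0 := by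
  obtain ⟨_, hzu, v, hv, rfl⟩ := Submodule.mem_sup.1 hx
  obtain ⟨z, hz, u, hu, rfl⟩ := Submodule.mem_sup.1 hzu
  have h1 : ⁅(A : g), z + u + v⁆ = δ A • (u - v) := by
    rw [lie_add, lie_add, hz A, hu A, hv A]
    simp only [LinearMap.neg_apply, LinearMap.zero_apply]
    module
  have h2 : ⁅(A : g), u - v⁆ = δ A • (u + v) := by
    rw [lie_sub, hu A, hv A]
    simp only [LinearMap.neg_apply]
    module
  rw [h, eq_comm, smul_eq_zero_iff_right hAA.ne'] at h1
  rw [h1, lie_zero, eq_comm, smul_eq_zero_iff_right hAA.ne'] at h2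
  rw [add_assoc, h2, add_zero]
  exact hz

theorem IsCartanSubspace.eq_zero_of_killingForm_eq_zero (hθ : IsCartanInvolution θ)
    (ha : IsCartanSubspace θ a) {x : g} (hx : x ∈ rankOneSubmodule a δ)
    (h : ∀ y ∈ rankOneSubmodule a δ, killingForm ℝ g x y = 0) : x = 0 := by
  by_contra hx0
  exact (hθ.killingForm_neg hx0).ne (h _ (ha.map_mem_rankOneSubmodule hx))

/-- An element of the rank one subalgebra centralizing its `-1`-eigenspace vanishes. -/
theorem IsCartanSubspace.eq_zero_of_lie_rankOneParam (hθ : IsCartanInvolution θ)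
    (ha : IsCartanSubspace θ a) {A : a} (hAA : 0 < δ A) {x : g} (hx : x ∈ rankOneSubmodule a δ)
    (h : ∀ p, ⁅x, rankOneParam θ A δ p⁆ = 0) : x = 0 := by
  have hxA : ⁅x, (A : g)⁆ = 0 := by simpa [rankOneParam_apply] using h (1, 0)
  have hsub : ∀ u ∈ restrictedRootSpace a δ, ⁅x, u⁆ - ⁅x, θ u⁆ = 0 := fun u hu => by
    simpa [rankOneParam_apply] using h (0, ⟨u, hu⟩)
  -- `ad A` carries `u - θ u` to a multiple of `u + θ u`, and `x` commutes with `A`. Hence `x`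
  -- centralizes `u`, which makes it Killing-orthogonal to the whole `θ`-stable span.
  have hadd : ∀ u ∈ restrictedRootSpace a δ, ⁅x, u⁆ + ⁅x, θ u⁆ = 0 := fun u hu => by
    have e := leibniz_lie x (A : g) (rankOneParam θ A δ (0, ⟨u, hu⟩))
    rw [hxA, h, zero_lie, lie_zero, add_zero, ha.lie_rankOneParam, lie_smul,
      smul_eq_zero_iff_right hAA.ne', lie_add] at e
    exact e
  have hu0 : ∀ u ∈ restrictedRootSpace a δ, ⁅x, u⁆ = 0 := fun u hu => by
    have : (2 : ℝ) • ⁅x, u⁆ = 0 := by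
      rw [two_smul]
      nth_rewrite 1 [sub_eq_zero.1 (hsub u hu)]
      rw [add_comm]
      exact hadd u hu
    simpa using this
  refine ha.eq_zero_of_killingForm_eq_zero hθ hx fun y hy => ?_
  refine rankOneSubmodule_le (P := LinearMap.ker (killingForm ℝ g x)) (fun u hu => ?_)
    (fun v hv => ?_) (fun u hu v hv => ?_) hy
  · have e : killingForm ℝ g x ⁅(A : g), u⁆ = 0 := by
      rw [← killingForm_lie_left, hxA, map_zero, LinearMap.zero_apply]
    rw [hu A, map_smul, smul_eq_zero_iff_right hAA.ne'] at e
    exact e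
  · have e : killingForm ℝ g x ⁅(A : g), v⁆ = 0 := by
      rw [← killingForm_lie_left, hxA, map_zero, LinearMap.zero_apply]
    rw [hv A, map_smul] at e
    exact (smul_eq_zero.1 e).resolve_left (neg_ne_zero.2 hAA.ne')
  · rw [LinearMap.mem_ker, ← killingForm_lie_left, hu0 u hu, map_zero, LinearMap.zero_apply]

variable [FiniteDimensional ℝ g]

theorem IsCartanSubspace.sub_map_mem_range_rankOneParam (hθ : IsCartanInvolution θ)
    (ha : IsCartanSubspace θ a) {A : a} (hA : ∀ H : a, killingForm ℝ g A H = δ H) {x : g}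
    (hx : x ∈ rankOneSubmodule a δ) : x - θ x ∈ LinearMap.range (rankOneParam θ A δ) := by
  refine rankOneSubmodule_le (P := (LinearMap.range (rankOneParam θ A δ)).comap
    (LinearMap.id - (θ : g →ₗ[ℝ] g))) (fun u hu => ?_) (fun v hv => ?_) (fun u hu v hv => ?_) hx
  · exact ⟨(0, ⟨u, hu⟩), by simp [rankOneParam_apply]⟩
  · refine ⟨(0, ⟨-θ v, neg_mem (ha.map_mem_of_neg hv)⟩), ?_⟩
    simp only [rankOneParam_apply, map_neg, hθ.involutive, zero_smul, LinearMap.sub_apply,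
      LinearMap.id_apply]
    change _ = v - θ v
    abel
  · have h := ha.lie_map_add_lie_map hθ hA hu (ha.map_mem_of_neg hv)
    rw [hθ.involutive, ← lie_skew (θ v), ← sub_eq_add_neg, ← LieEquiv.map_lie θ] at h
    refine ⟨(2 * killingForm ℝ g u v, 0), ?_⟩
    rw [rankOneParam_apply]
    simpa using h.symm

theorem IsCartanSubspace.mem_range_rankOneParam (hθ : IsCartanInvolution θ)
    (ha : IsCartanSubspace θ a) {A : a} (hA : ∀ H : a, killingForm ℝ g A H = δ H) {x : g}
    (hx : x ∈ rankOneSubmodule a δ) (hxθ : θ x = -x) :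
    x ∈ LinearMap.range (rankOneParam θ A δ) := by
  have h := ha.sub_map_mem_range_rankOneParam hθ hA hx
  rw [hxθ, sub_neg_eq_add, ← two_smul ℝ] at h
  exact (Submodule.smul_mem_iff _ two_ne_zero).1 h

theorem IsCartanSubspace.dual_mem_rankOneSubmodule (hθ : IsCartanInvolution θ)
    (ha : IsCartanSubspace θ a) (hδ : δ ∈ restrictedRoots a) {A : a}
    (hA : ∀ H : a, killingForm ℝ g A H = δ H) : (A : g) ∈ rankOneSubmodule a δ := by
  obtain ⟨u, hu, hu0⟩ := (Submodule.ne_bot_iff _).1 hδ.2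
  have h := lie_mem_rankOneSubmodule_of_mem hu (ha.map_mem hu)
  rw [ha.lie_map_self hθ hA hu] at h
  exact (Submodule.smul_mem_iff _ (hθ.killingForm_neg hu0).ne).1 h

theorem IsCartanSubspace.rankOneParam_mem (hθ : IsCartanInvolution θ)
    (ha : IsCartanSubspace θ a) (hδ : δ ∈ restrictedRoots a) {A : a}
    (hA : ∀ H : a, killingForm ℝ g A H = δ H) (p : ℝ × restrictedRootSpace a δ) :
    rankOneParam θ A δ p ∈ rankOneSubmodule a δ :=
  add_mem (Submodule.smul_mem _ _ (ha.dual_mem_rankOneSubmodule hθ hδ hA))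
    (sub_mem (mem_rankOneSubmodule_of_mem p.2.2)
      (mem_rankOneSubmodule_of_mem_neg (ha.map_mem p.2.2)))

/-- The rank one subalgebra has no proper nonzero ideals. -/
theorem IsCartanSubspace.eq_rankOneSubmodule_of_lie_mem (hθ : IsCartanInvolution θ)
    (ha : IsCartanSubspace θ a) (hδ : δ ∈ restrictedRoots a) {J : Submodule ℝ g}
    (hJR : J ≤ rankOneSubmodule a δ) (hJ : J ≠ ⊥)
    (hlie : ∀ y ∈ rankOneSubmodule a δ, ∀ x ∈ J, ⁅y, x⁆ ∈ J) : J = rankOneSubmodule a δ := by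
  obtain ⟨A, hA⟩ := ha.exists_dual hθ δ
  have hAA := ha.dual_apply_self_pos hθ hδ.1 hA
  have hAR := ha.dual_mem_rankOneSubmodule hθ hδ hA
  have hu : ∀ u ∈ restrictedRootSpace a δ, u ∈ J → u ≠ 0 → (A : g) ∈ J := by
    intro u hu huJ hu0
    have h := hlie _ (mem_rankOneSubmodule_of_mem_neg (ha.map_mem hu)) u huJ
    rw [← lie_skew, ha.lie_map_self hθ hA hu, neg_mem_iff] at h
    exact (Submodule.smul_mem_iff _ (hθ.killingForm_neg hu0).ne).1 h
  have hv : ∀ v ∈ restrictedRootSpace a (-δ), v ∈ J → v ≠ 0 → (A : g) ∈ J := by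
    intro v hv hvJ hv0
    have h := hlie _ (mem_rankOneSubmodule_of_mem (ha.map_mem_of_neg hv)) v hvJ
    have h1 := ha.lie_map_self hθ hA (ha.map_mem_of_neg hv)
    rw [hθ.involutive, killingForm_comm] at h1
    rw [h1] at h
    exact (Submodule.smul_mem_iff _ (hθ.killingForm_neg hv0).ne).1 h
  -- It suffices to find a nonzero vector of `g_{±δ}` in `J`. If `x` does not commute with `A`,
  -- applying `ad A` twice isolates its components there; otherwise `x` lies in `g_0`, and some
  -- bracket with `g_{±δ}` is nonzero.
  have hAJ : (A : g) ∈ J := by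
    obtain ⟨x, hxJ, hx0⟩ := (Submodule.ne_bot_iff _).1 hJ
    have hxs := rankOneSubmodule_le_sup (hJR hxJ)
    by_cases hAx : ⁅(A : g), x⁆ = 0
    · have hx := mem_restrictedRootSpace_zero_of_lie_eq_zero hAA hxs hAx
      by_contra hAJ
      have hxu : ∀ u ∈ restrictedRootSpace a δ, ⁅x, u⁆ = 0 := by
        intro u hu'
        by_contra hne
        refine hAJ (hu _ (lie_mem_of_mem_zero hx hu') ?_ hne)
        rw [← lie_skew]
        exact neg_mem (hlie _ (mem_rankOneSubmodule_of_mem hu') _ hxJ)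
      have hxv : ∀ v ∈ restrictedRootSpace a (-δ), ⁅x, v⁆ = 0 := by
        intro v hv'
        by_contra hne
        refine hAJ (hv _ (lie_mem_of_mem_zero hx hv') ?_ hne)
        rw [← lie_skew]
        exact neg_mem (hlie _ (mem_rankOneSubmodule_of_mem_neg hv') _ hxJ)
      refine hx0 (ha.eq_zero_of_lie_rankOneParam hθ hAA (hJR hxJ) fun p => ?_)
      rw [rankOneParam_apply, lie_add, lie_smul, ← lie_skew, hAx, lie_sub, hxu _ p.2.2,
        hxv _ (ha.map_mem p.2.2)]
      simp
    · obtain ⟨_, hzu, v, hv', rfl⟩ := Submodule.mem_sup.1 hxs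
      obtain ⟨z, hz, u, hu', rfl⟩ := Submodule.mem_sup.1 hzu
      have h1 : ⁅(A : g), z + u + v⁆ = δ A • (u - v) := by
        rw [lie_add, lie_add, hz A, hu' A, hv' A]
        simp only [LinearMap.neg_apply, LinearMap.zero_apply]
        module
      have h2 : ⁅(A : g), u - v⁆ = δ A • (u + v) := by
        rw [lie_sub, hu' A, hv' A]
        simp only [LinearMap.neg_apply]
        module
      have h3 : u - v ∈ J := by
        have := hlie _ hAR _ hxJ
        rw [h1] at this
        exact (Submodule.smul_mem_iff _ hAA.ne').1 this
      have h4 : u + v ∈ J := by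
        have := hlie _ hAR _ h3
        rw [h2] at this
        exact (Submodule.smul_mem_iff _ hAA.ne').1 this
      have h5 : u ∈ J := by
        refine (Submodule.smul_mem_iff _ (two_ne_zero (α := ℝ))).1 ?_
        convert! add_mem h3 h4 using 1
        module
      have h6 : v ∈ J := by simpa using sub_mem h4 h5
      by_cases hu0 : u = 0
      · refine hv v hv' h6 ?_
        rintro rfl
        rw [h1, hu0] at hAx
        simp at hAx
      · exact hu u hu' h5 hu0
  have hδJ : ∀ u ∈ restrictedRootSpace a δ, u ∈ J := by
    intro u hu'
    have := hlie _ (mem_rankOneSubmodule_of_mem hu') _ hAJ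
    rw [← lie_skew, neg_mem_iff, hu' A] at this
    exact (Submodule.smul_mem_iff _ hAA.ne').1 this
  refine hJR.antisymm (rankOneSubmodule_le hδJ (fun v hv' => ?_) (fun u hu' v hv' => ?_))
  · have := hlie _ (mem_rankOneSubmodule_of_mem_neg hv') _ hAJ
    rw [← lie_skew, neg_mem_iff, hv' A] at this
    exact (Submodule.smul_mem_iff _ (neg_ne_zero.2 hAA.ne')).1 this
  · rw [← lie_skew]
    exact neg_mem (hlie _ (mem_rankOneSubmodule_of_mem_neg hv') _ (hδJ u hu'))

end RankOneIdeal

/-! ### Compactness of the other simple ideals, and identification of `ĝ(δ)`. -/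

section NoncompactPart

variable {g : Type*} [LieRing g] [LieAlgebra ℝ g] {θ : g ≃ₗ⁅ℝ⁆ g} {a : Submodule ℝ g}
  {δ : Module.Dual ℝ a}

/-- The rank one subalgebra as an ideal of `g_{Γ_δ}`. -/
def rankOneIdeal (a : Submodule ℝ g) (δ : Module.Dual ℝ a)
    (hR : ∀ x ∈ multiplesSubalgebra a δ, ∀ y ∈ rankOneSubmodule a δ,
      ⁅x, y⁆ ∈ rankOneSubmodule a δ) : LieIdeal ℝ (multiplesSubalgebra a δ) where
  toSubmodule := (rankOneSubmodule a δ).comap (multiplesSubalgebra a δ).toSubmodule.subtype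
  lie_mem {x m} hm := hR x x.2 m hm

/-- The embedding of an ideal of a Lie subalgebra into the ambient Lie algebra. -/
def LieIdeal.ambientIncl {L : LieSubalgebra ℝ g} (I : LieIdeal ℝ L) : I →ₗ⁅ℝ⁆ g :=
  L.incl.comp I.incl

theorem LieIdeal.ambientIncl_injective {L : LieSubalgebra ℝ g} (I : LieIdeal ℝ L) :
    Function.Injective I.ambientIncl :=
  fun _ _ h => Subtype.ext (Subtype.ext h)

theorem LieIdeal.ambientIncl_mem {L : LieSubalgebra ℝ g} (I : LieIdeal ℝ L) (x : I) :
    I.ambientIncl x ∈ L := (x : L).2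

section Ideal

variable {hR : ∀ x ∈ multiplesSubalgebra a δ, ∀ y ∈ rankOneSubmodule a δ,
  ⁅x, y⁆ ∈ rankOneSubmodule a δ}

theorem ambientIncl_mem_rankOneSubmodule (x : rankOneIdeal a δ hR) :
    (rankOneIdeal a δ hR).ambientIncl x ∈ rankOneSubmodule a δ := x.2

theorem exists_ambientIncl_eq (hL : rankOneSubmodule a δ ≤ (multiplesSubalgebra a δ).toSubmodule)
    {x : g} (hx : x ∈ rankOneSubmodule a δ) :
    ∃ y, (rankOneIdeal a δ hR).ambientIncl y = x :=
  ⟨⟨⟨x, hL hx⟩, hx⟩, rfl⟩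

/-- The Cartan involution restricted to the rank one ideal. -/
def rankOneInvolution (ha : IsCartanSubspace θ a)
    (hR : ∀ x ∈ multiplesSubalgebra a δ, ∀ y ∈ rankOneSubmodule a δ,
      ⁅x, y⁆ ∈ rankOneSubmodule a δ)
    (hL : rankOneSubmodule a δ ≤ (multiplesSubalgebra a δ).toSubmodule) :
    rankOneIdeal a δ hR →ₗ⁅ℝ⁆ rankOneIdeal a δ hR where
  toFun x := ⟨⟨θ x, hL (ha.map_mem_rankOneSubmodule (ambientIncl_mem_rankOneSubmodule x))⟩,
    ha.map_mem_rankOneSubmodule (ambientIncl_mem_rankOneSubmodule x)⟩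
  map_add' _ _ := Subtype.ext (Subtype.ext (map_add θ _ _))
  map_smul' c _ := Subtype.ext (Subtype.ext (map_smul θ c _))
  map_lie' {_ _} := Subtype.ext (Subtype.ext (LieEquiv.map_lie θ _ _))

variable [FiniteDimensional ℝ g]

theorem rankOneIdeal_isSimple (hθ : IsCartanInvolution θ) (ha : IsCartanSubspace θ a)
    (hδ : δ ∈ restrictedRoots a)
    (hL : rankOneSubmodule a δ ≤ (multiplesSubalgebra a δ).toSubmodule) :
    LieAlgebra.IsSimple ℝ (rankOneIdeal a δ hR) := by
  set I := rankOneIdeal a δ hR with hI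
  refine ⟨fun J => ?_, fun habel => ?_⟩
  · by_cases hJ : J = ⊥
    · exact Or.inl hJ
    refine Or.inr ?_
    have hmap : J.toSubmodule.map (I.ambientIncl : I →ₗ[ℝ] g) = rankOneSubmodule a δ := by
      refine ha.eq_rankOneSubmodule_of_lie_mem hθ hδ ?_ ?_ ?_
      · rintro _ ⟨x, -, rfl⟩
        exact x.2
      · intro h
        refine hJ ?_
        rw [LieSubmodule.eq_bot_iff]
        intro x hx
        have h0 : I.ambientIncl x ∈ J.toSubmodule.map (I.ambientIncl : I →ₗ[ℝ] g) := ⟨x, hx, rfl⟩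
        rw [h, Submodule.mem_bot] at h0
        exact I.ambientIncl_injective (h0.trans (map_zero I.ambientIncl).symm)
      · rintro y hy _ ⟨x, hx, rfl⟩
        obtain ⟨y, rfl⟩ := exists_ambientIncl_eq (hR := hR) hL hy
        exact ⟨⁅y, x⁆, J.lie_mem hx, LieHom.map_lie I.ambientIncl y x⟩
    refine eq_top_iff.2 fun x _ => ?_
    obtain ⟨y, hy, hyx⟩ : I.ambientIncl x ∈ J.toSubmodule.map (I.ambientIncl : I →ₗ[ℝ] g) := by
      rw [hmap]
      exact ambientIncl_mem_rankOneSubmodule x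
    rwa [← I.ambientIncl_injective hyx]
  · obtain ⟨A, hA⟩ := ha.exists_dual hθ δ
    have hAA := ha.dual_apply_self_pos hθ hδ.1 hA
    obtain ⟨u, hu, hu0⟩ := (Submodule.ne_bot_iff _).1 hδ.2
    obtain ⟨A', hA'⟩ := exists_ambientIncl_eq (hR := hR) hL
      (ha.dual_mem_rankOneSubmodule hθ hδ hA)
    obtain ⟨u', hu'⟩ := exists_ambientIncl_eq (hR := hR) hL (mem_rankOneSubmodule_of_mem hu)
    have h := congrArg I.ambientIncl (habel.trivial A' u')
    rw [LieHom.map_lie, hA', hu', hu A, map_zero] at h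
    exact smul_ne_zero hAA.ne' hu0 h

end Ideal

theorem LieIdeal.killingForm_eq_trace {L : LieSubalgebra ℝ g} (I : LieIdeal ℝ L) (x : I) :
    killingForm ℝ I x x =
      LinearMap.trace ℝ I ((LieAlgebra.ad ℝ I x : I →ₗ[ℝ] I) ∘ₗ (LieAlgebra.ad ℝ I x : I →ₗ[ℝ] I)) :=
  rfl

/-- The positive definite form of a Cartan involution restricted to an ideal. -/
noncomputable def LieIdeal.cartanForm {L : LieSubalgebra ℝ g} (I : LieIdeal ℝ L)
    (θ : g ≃ₗ⁅ℝ⁆ g) : LinearMap.BilinForm ℝ I :=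
  -((killingForm ℝ g).compl₁₂ (I.ambientIncl : I →ₗ[ℝ] g)
    ((θ : g →ₗ[ℝ] g) ∘ₗ (I.ambientIncl : I →ₗ[ℝ] g)))

theorem LieIdeal.cartanForm_apply {L : LieSubalgebra ℝ g} (I : LieIdeal ℝ L)
    (θ : g ≃ₗ⁅ℝ⁆ g) (x y : I) :
    I.cartanForm θ x y = -killingForm ℝ g (I.ambientIncl x) (θ (I.ambientIncl y)) := rfl

theorem LieIdeal.cartanForm_pos (hθ : IsCartanInvolution θ) {L : LieSubalgebra ℝ g}
    (I : LieIdeal ℝ L) (x : I) (hx : x ≠ 0) : 0 < I.cartanForm θ x x :=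
  hθ.pos_def _ fun h => hx (I.ambientIncl_injective (h.trans (map_zero I.ambientIncl).symm))

/-- For `p` in `g_0`, the vector `p - θ p` lies in `a` by maximality and so commutes with `g_0`.
Brackets in `g_0` thus see only the `θ`-fixed parts. -/
theorem IsCartanSubspace.map_lie_of_mem_zero (hθ : IsCartanInvolution θ)
    (ha : IsCartanSubspace θ a) {x y : g} (hx : x ∈ restrictedRootSpace a 0)
    (hy : y ∈ restrictedRootSpace a 0) : θ ⁅x, y⁆ = ⁅x, y⁆ := by
  have key : ∀ p q : g, p ∈ restrictedRootSpace a 0 → q ∈ restrictedRootSpace a 0 →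
      ⁅θ p, q⁆ = ⁅p, q⁆ := by
    intro p q hp hq
    have hθp : θ p ∈ restrictedRootSpace a 0 := by simpa using ha.map_mem hp
    have hpa : p - θ p ∈ a := by
      refine ha.maximal _ (by rw [map_sub, hθ.involutive, neg_sub]) fun H hH => ?_
      have := (sub_mem hp hθp) ⟨H, hH⟩
      rw [LinearMap.zero_apply, zero_smul] at this
      rw [← lie_skew, this, neg_zero]
    have h := hq ⟨_, hpa⟩
    rw [LinearMap.zero_apply, zero_smul, sub_lie] at h
    exact (sub_eq_zero.1 h).symm
  have hθy : θ y ∈ restrictedRootSpace a 0 := by simpa using ha.map_mem hy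
  rw [LieEquiv.map_lie, key x _ hx hθy, ← lie_skew, key y x hy hx, lie_skew]

/-- All brackets of `I` are fixed by `θ`, so the fixed vectors form an ideal; it is nonzero because
`I` is not abelian. -/
theorem LieIdeal.map_ambientIncl_of_le_zero (hθ : IsCartanInvolution θ)
    (ha : IsCartanSubspace θ a) {L : LieSubalgebra ℝ g} (I : LieIdeal ℝ L)
    (hI : LieAlgebra.IsSimple ℝ I) (h0 : ∀ x, I.ambientIncl x ∈ restrictedRootSpace a 0) (x : I) :
    θ (I.ambientIncl x) = I.ambientIncl x := by
  have hlie : ∀ y z : I, θ (I.ambientIncl ⁅y, z⁆) = I.ambientIncl ⁅y, z⁆ := fun y z => by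
    rw [LieHom.map_lie]
    exact ha.map_lie_of_mem_zero hθ (h0 y) (h0 z)
  let J : LieIdeal ℝ I :=
    { carrier := {y | θ (I.ambientIncl y) = I.ambientIncl y}
      add_mem' := fun {y z} hy hz => by
        simp only [Set.mem_ofPred_eq] at hy hz ⊢
        rw [map_add, map_add, hy, hz]
      zero_mem' := by simp
      smul_mem' := fun c y hy => by
        simp only [Set.mem_ofPred_eq] at hy ⊢
        rw [map_smul, map_smul, hy]
      lie_mem := fun {y z} _ => hlie y z }
  rcases hI.eq_bot_or_eq_top J with hJ | hJ
  · refine absurd ⟨fun y z => ?_⟩ hI.non_abelian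
    have : ⁅y, z⁆ ∈ J := hlie y z
    rwa [hJ, LieSubmodule.mem_bot] at this
  · have : x ∈ J := hJ ▸ LieSubmodule.mem_top x
    exact this

variable [FiniteDimensional ℝ g]

instance LieIdeal.finiteDimensional_of_lieSubalgebra {L : LieSubalgebra ℝ g} (I : LieIdeal ℝ L) :
    FiniteDimensional ℝ I :=
  Module.Finite.of_injective (I.ambientIncl : I →ₗ[ℝ] g) I.ambientIncl_injective

theorem LieIdeal.cartanForm_symm (hθ : IsCartanInvolution θ) {L : LieSubalgebra ℝ g}
    (I : LieIdeal ℝ L) (x y : I) : I.cartanForm θ x y = I.cartanForm θ y x := by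
  rw [cartanForm_apply, cartanForm_apply, hθ.killingForm_map_right, killingForm_comm]

/-- When `θ` negates `x`, the operator `ad x` is symmetric for `cartanForm`, so its square has
nonnegative trace. -/
theorem LieIdeal.killingForm_self_nonneg (hθ : IsCartanInvolution θ) {L : LieSubalgebra ℝ g}
    (I : LieIdeal ℝ L) {x : I} (hx : θ (I.ambientIncl x) = -I.ambientIncl x) :
    0 ≤ killingForm ℝ I x x := by
  rw [I.killingForm_eq_trace]
  refine LinearMap.BilinForm.trace_comp_self_nonneg (I.cartanForm_symm hθ) (I.cartanForm_pos hθ)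
    fun y z => ?_
  rw [cartanForm_apply, cartanForm_apply, LieAlgebra.ad_apply, LieAlgebra.ad_apply, LieHom.map_lie,
    LieHom.map_lie, LieEquiv.map_lie, hx, killingForm_lie_right, neg_lie, map_neg,
    LinearMap.neg_apply, neg_neg]

/-- A simple ideal fixed by a Cartan involution is compact. -/
theorem LieIdeal.killingForm_self_neg (hθ : IsCartanInvolution θ) {L : LieSubalgebra ℝ g}
    (I : LieIdeal ℝ L) (hI : LieAlgebra.IsSimple ℝ I)
    (hfix : ∀ x, θ (I.ambientIncl x) = I.ambientIncl x) {x : I} (hx : x ≠ 0) :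
    killingForm ℝ I x x < 0 := by
  rw [I.killingForm_eq_trace]
  refine LinearMap.BilinForm.trace_comp_self_neg (I.cartanForm_symm hθ) (I.cartanForm_pos hθ)
    (fun y z => ?_) fun h => ?_
  · rw [cartanForm_apply, cartanForm_apply, LieAlgebra.ad_apply, LieAlgebra.ad_apply,
      LieHom.map_lie, LieHom.map_lie, LieEquiv.map_lie, hfix x, killingForm_lie_right, neg_neg]
  · have hc : x ∈ LieAlgebra.center ℝ I := by
      rw [LieModule.mem_maxTrivSubmodule]
      intro y
      rw [← lie_skew, neg_eq_zero]
      exact LinearMap.congr_fun h y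
    rcases hI.eq_bot_or_eq_top (LieAlgebra.center ℝ I) with h0 | h1
    · rw [h0] at hc
      exact hx ((LieSubmodule.mem_bot x).1 hc)
    · exact hI.non_abelian ((LieAlgebra.isLieAbelian_iff_center_eq_top ℝ I).2 h1)

/-- The non-compact semisimple part of `g_{Γ_δ}` is the rank one ideal. -/
theorem mobiusSubalgebra_eq_rankOneIdeal (hθ : IsCartanInvolution θ) (ha : IsCartanSubspace θ a)
    (hδ : δ ∈ restrictedRoots a) (h2 : restrictedRootSpace a ((2 : ℝ) • δ) = ⊥)
    (hR : ∀ x ∈ multiplesSubalgebra a δ, ∀ y ∈ rankOneSubmodule a δ,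
      ⁅x, y⁆ ∈ rankOneSubmodule a δ)
    (hL : rankOneSubmodule a δ ≤ (multiplesSubalgebra a δ).toSubmodule) :
    mobiusSubalgebra a δ = rankOneIdeal a δ hR := by
  obtain ⟨A, hA⟩ := ha.exists_dual hθ δ
  have hAA := ha.dual_apply_self_pos hθ hδ.1 hA
  obtain ⟨A', hA'⟩ := exists_ambientIncl_eq (hR := hR) hL (ha.dual_mem_rankOneSubmodule hθ hδ hA)
  have hA0 : A' ≠ 0 := by
    rintro rfl
    rw [map_zero] at hA'
    have h0 := hA A
    rw [← hA', map_zero] at h0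
    exact hAA.ne h0
  refine le_antisymm (sSup_le ?_) (le_sSup ⟨rankOneIdeal_isSimple hθ ha hδ hL, fun h => ?_⟩)
  · rintro I ⟨hI, hnc⟩
    -- A simple ideal either meets the rank one ideal trivially or lies inside it. In the first case
    -- its brackets with `A'` fall in the intersection, so it centralizes `A` and sits in `g_0`,
    -- which makes it compact.
    rcases hI.eq_bot_or_eq_top (LieIdeal.comap I.incl (rankOneIdeal a δ hR)) with hJ | hJ
    · refine absurd (fun x hx => I.killingForm_self_neg hθ hI ?_ hx) hnc
      refine I.map_ambientIncl_of_le_zero hθ ha hI fun x => ?_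
      refine mem_restrictedRootSpace_zero_of_lie_eq_zero hAA ?_ ?_
      · rw [← ha.toSubmodule_multiplesSubalgebra hθ hδ h2]
        exact I.ambientIncl_mem x
      · have h1 : ⁅(A' : multiplesSubalgebra a δ), (x : multiplesSubalgebra a δ)⁆ ∈ I :=
          I.lie_mem x.2
        have h2 : ⁅(A' : multiplesSubalgebra a δ), (x : multiplesSubalgebra a δ)⁆ ∈
            rankOneIdeal a δ hR := by
          rw [← lie_skew]
          exact neg_mem ((rankOneIdeal a δ hR).lie_mem A'.2)
        have h3 : (⟨_, h1⟩ : I) ∈ LieIdeal.comap I.incl (rankOneIdeal a δ hR) := by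
          rw [LieIdeal.mem_comap]
          exact h2
        rw [hJ, LieSubmodule.mem_bot] at h3
        rw [← hA']
        exact congrArg I.ambientIncl h3
    · intro x hx
      have : (⟨x, hx⟩ : I) ∈ LieIdeal.comap I.incl (rankOneIdeal a δ hR) :=
        hJ ▸ LieSubmodule.mem_top _
      rwa [LieIdeal.mem_comap] at this
  · refine (h A' hA0).not_ge (LieIdeal.killingForm_self_nonneg hθ _ ?_)
    rw [hA', ha.neg _ A.2]

/-- The rank one ideal is isomorphic to `so(1, n + 1)`, where `n = dim g_δ`. -/
theorem rankOneIdeal_nonempty_lieEquiv_so' (hθ : IsCartanInvolution θ) (ha : IsCartanSubspace θ a)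
    (hδ : δ ∈ restrictedRoots a) (h2 : restrictedRootSpace a ((2 : ℝ) • δ) = ⊥)
    (hR : ∀ x ∈ multiplesSubalgebra a δ, ∀ y ∈ rankOneSubmodule a δ,
      ⁅x, y⁆ ∈ rankOneSubmodule a δ)
    (hL : rankOneSubmodule a δ ≤ (multiplesSubalgebra a δ).toSubmodule) :
    Nonempty (rankOneIdeal a δ hR ≃ₗ⁅ℝ⁆ LieAlgebra.Orthogonal.so' (Fin 1)
      (Fin (Module.finrank ℝ (restrictedRootSpace a δ) + 1)) ℝ) := by
  obtain ⟨A, hA⟩ := ha.exists_dual hθ δ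
  have hAA := ha.dual_apply_self_pos hθ hδ.1 hA
  set V := LinearMap.range (rankOneParam θ A δ) with hV
  have hfr : Module.finrank ℝ V = Module.finrank ℝ (restrictedRootSpace a δ) + 1 := by
    rw [hV, LinearMap.finrank_range_of_inj (ha.rankOneParam_injective hAA), Module.finrank_prod,
      Module.finrank_self, add_comm]
  have hVneg : ∀ x ∈ V, θ x = -x := by
    rintro _ ⟨p, rfl⟩
    exact ha.map_rankOneParam hθ A p
  have hVmem : ∀ x ∈ V, x ∈ rankOneSubmodule a δ := by
    rintro _ ⟨p, rfl⟩
    exact ha.rankOneParam_mem hθ hδ hA p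
  rw [← hfr]
  -- The scaling by `δ A` absorbs the constant in `lie_triple`, normalizing the curvature to `-1`.
  obtain ⟨e, he⟩ := LinearMap.BilinForm.exists_orthonormal_basis (V := V)
    (β := (δ A • killingForm ℝ g).restrict V)
    (fun x y => by
      change δ A * killingForm ℝ g x y = δ A * killingForm ℝ g y x
      rw [killingForm_comm])
    (fun x hx => by
      change 0 < δ A * killingForm ℝ g x x
      refine mul_pos hAA ?_
      have := hθ.killingForm_neg (x := (x : g)) (by simpa using hx)
      rw [hVneg x x.2, map_neg] at this
      linarith)
  have he' : ∀ i j, δ A * killingForm ℝ g (e i) (e j) = if i = j then 1 else 0 := he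
  set I := rankOneIdeal a δ hR with hI
  choose f hf using fun i => exists_ambientIncl_eq (hR := hR) hL (hVmem _ (e i).2)
  have hF : IsHyperbolicFrame
      ((δ A • killingForm ℝ g).compl₁₂ (I.ambientIncl : I →ₗ[ℝ] g) (I.ambientIncl : I →ₗ[ℝ] g))
      (rankOneInvolution ha hR hL) f := by
    have hκ : ∀ x y : I, (δ A • killingForm ℝ g).compl₁₂ (I.ambientIncl : I →ₗ[ℝ] g)
        (I.ambientIncl : I →ₗ[ℝ] g) x y =
        δ A * killingForm ℝ g (I.ambientIncl x) (I.ambientIncl y) := fun x y => rfl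
    have hθI : ∀ x : I, I.ambientIncl (rankOneInvolution ha hR hL x) = θ (I.ambientIncl x) :=
      fun x => rfl
    have hmemV : ∀ x : I, rankOneInvolution ha hR hL x = -x → I.ambientIncl x ∈ V := by
      intro x hx
      refine ha.mem_range_rankOneParam hθ hA (ambientIncl_mem_rankOneSubmodule x) ?_
      rw [← map_neg, ← hx, hθI]
    refine ⟨fun x y => ?_, fun x y z => ?_, fun x => ?_, fun x y => ?_, fun i => ?_, fun i j => ?_,
      fun x hx => ?_, fun x y z hx hy hz => ?_, fun x hx h => ?_⟩
    · rw [hκ, hκ, killingForm_comm]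
    · rw [hκ, hκ, LieHom.map_lie, LieHom.map_lie, killingForm_lie_left]
    · refine I.ambientIncl_injective ?_
      rw [hθI, hθI, hθ.involutive]
    · rw [hκ, hκ, hθI, hθI, killingForm_map_map]
    · refine I.ambientIncl_injective ?_
      rw [hθI, map_neg, hf, hVneg _ (e i).2]
    · rw [hκ, hf, hf, he']
    · refine I.ambientIncl_injective ?_
      rw [map_sum]
      have h1 := e.sum_repr ⟨_, hmemV x hx⟩
      have h2 := congrArg (Subtype.val) h1
      rw [Submodule.coe_sum] at h2
      refine Eq.trans ?_ h2
      refine Finset.sum_congr rfl fun i _ => ?_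
      rw [map_smul, Submodule.coe_smul, hf, hκ, hf,
        LinearMap.BilinForm.repr_eq_of_orthonormal e he, killingForm_comm]
      rfl
    · refine I.ambientIncl_injective ?_
      obtain ⟨p, hp⟩ := hmemV x hx
      obtain ⟨q, hq⟩ := hmemV y hy
      obtain ⟨r, hr⟩ := hmemV z hz
      rw [LieHom.map_lie, LieHom.map_lie, map_sub, map_smul, map_smul, hκ, hκ, ← hp, ← hq, ← hr]
      exact ha.lie_triple hθ h2 hA hδ.1 p.2.2 q.2.2 r.2.2 p.1 q.1 r.1
    · refine I.ambientIncl_injective ?_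
      rw [map_zero]
      refine ha.eq_zero_of_lie_rankOneParam hθ hAA (ambientIncl_mem_rankOneSubmodule x)
        fun p => ?_
      have h1 := e.sum_repr ⟨rankOneParam θ A δ p, ⟨p, rfl⟩⟩
      have h2 := congrArg (Subtype.val) h1
      rw [Submodule.coe_sum] at h2
      change _ = rankOneParam θ A δ p at h2
      rw [← h2, lie_sum]
      refine Finset.sum_eq_zero fun i _ => ?_
      rw [Submodule.coe_smul, lie_smul, ← hf, ← LieHom.map_lie, h, map_zero, smul_zero]
  exact hF.nonempty_lieEquiv_so'

end NoncompactPart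

theorem proposition4 {g : Type*} [LieRing g] [LieAlgebra ℝ g] [FiniteDimensional ℝ g]
    [LieAlgebra.IsSemisimple ℝ g]
    (θ : g ≃ₗ⁅ℝ⁆ g) (hθ : IsCartanInvolution θ)
    (a : Submodule ℝ g) (ha : IsCartanSubspace θ a)
    (pos : Module.Dual ℝ a → Prop) (hpos : IsPositivity pos)
    (h : LieSubalgebra ℝ g) (b : LinearMap.BilinForm ℝ g) (δ : Module.Dual ℝ a)
    (hform : IsAlgebraicFormulation a pos h b δ)
    (hg0 : ¬ restrictedRootSpace a 0 ≤ h.toSubmodule) :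
    (2 : ℝ) • δ ∉ restrictedRoots a ∧
    ∃ n : ℕ, 1 ≤ n ∧ Module.finrank ℝ (restrictedRootSpace a δ) = n ∧
      Nonempty (mobiusSubalgebra a δ ≃ₗ⁅ℝ⁆
        LieAlgebra.Orthogonal.so' (Fin 1) (Fin (n + 1)) ℝ) := by
  have h2 := hform.two_smul_distortion_notMem hpos hθ ha hg0
  have hδ := hform.distortion_mem_restrictedRoots hθ ha hg0
  have h2' := restrictedRootSpace_eq_bot (smul_ne_zero two_ne_zero hδ.1) h2
  have hL := ha.toSubmodule_multiplesSubalgebra hθ hδ h2'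
  have hR : ∀ x ∈ multiplesSubalgebra a δ, ∀ y ∈ rankOneSubmodule a δ,
      ⁅x, y⁆ ∈ rankOneSubmodule a δ := fun x hx y hy =>
    ha.lie_mem_rankOneSubmodule h2' (hL ▸ hx) hy
  have hL' : rankOneSubmodule a δ ≤ (multiplesSubalgebra a δ).toSubmodule :=
    hL ▸ rankOneSubmodule_le_sup
  refine ⟨h2, _, Submodule.one_le_finrank_iff.2 hδ.2, rfl, ?_⟩
  rw [mobiusSubalgebra_eq_rankOneIdeal hθ ha hδ h2' hR hL']
  exact rankOneIdeal_nonempty_lieEquiv_so' hθ ha hδ h2' hR hL'
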